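/- Let $H$ be a real Hilbert space, $r\in(0,\infty)$, $B_r(0)$ the open ball of radius $r$ at $0$. For nonempty $K\subseteq H$ put $\mathrm{Proj}_K(y)=\{x\in K:\|x-y\|=d(y,K)\}$ and $N_K(x)=\{\lambda(y-x): y\in H,\ x\in \mathrm{Proj}_K(y),\ \lambda\ge 0\}$. A nonempty closed set $K$ is $r$-prox-regular if, for every $y$ with $0<d(y,K)<r$, $\mathrm{Proj}_K(y)\neq\emptyset$ and $x\in \mathrm{Proj}_K\bigl(x+r\frac{y-x}{\|y-x\|}\bigr)$ for all $x\in \mathrm{Proj}_K(y)$. The excess is $e(Z_1,Z_2)=\sup_{z\in Z_1}d(z,Z_2)\in[0,\infty]$. For a set-valued map $C$ on $[0,\infty)$ and an interval $J$, $\mathrm{ret}(C,J)=\sup\sum_{j=1}^m e(C(t_{j-1}),C(t_j))$ over all $t_0<\dots<t_m$ in $J$; further $C(t\pm)=\{x:\lim_{s\to t\pm}d(x,C(s))=0\}$, with $C(0-)=C(0)$. Let $C(t)$, $t\ge 0$, be $r$-prox-regular sets with $\mathrm{ret}(C,J)<\infty$ for every compact interval $J\subset[0,\infty)$ and $e(C(t),C(t+))=0$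 for every $t\ge0$, and let $y_0\in C(0)+B_r(0)$. A solution of the sweeping process driven by $C$ with datum $y_0$ is a right-continuous function $y:[0,\infty)\to H$ of locally bounded variation such that $y(t)\in C(t)$ for all $t\ge 0$, $\mathrm{Proj}_{C(0)}(y_0)=\{y(0)\}$, and for some Borel measure $\mu$ on $[0,\infty)$ and some $v\in L^1_{\rm loc}(\mu;H)$ the differential measure of $y$ is $Dy=v\mu$, with $v(t)\in -N_{C(t)}(y(t))$ for $\mu$-a.e. $t$. We write $y=\mathrm{Sw}(C,y_0)$ if $y$ is a solution with $\|y(t)-y(t-)\|<r$ for all $t>0$, it is the only solution with this property, and $\mathrm{V}(y,[s,t])\le \mathrm{ret}(C,[s,t])$ for all $0\le s<t$. (i) If $e(C(t-),C(t))=0$ for every $t\ge 0$ (that is, $C$ is continuous), then $y=\mathrm{Sw}(C,y_0)$ exists and is continuous and of locally bounded variation on $[0,\infty)$. (ii) If there is a locally absolutely continuous $\alpha:[0,\infty)\to\mathbb R$ with $e(C(t),C(s))\le\int_t^s\alpha'(\tau)\,d\tau$ for all $0\le t<s$, then $y=\mathrm{Sw}(C,y_0)$ exists, is locally absolutely continuous,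 belongs to $W^{1,1}([0,T];H)$ for every $T>0$, and satisfies $y(t)\in C(t)$ for all $t\ge0$, $\mathrm{Proj}_{C(0)}(y_0)=\{y(0)\}$ and $y'(t)\in -N_{C(t)}(y(t))$ for Lebesgue-a.e. $t\ge0$. (iii) If there is $L\ge0$ with $e(C(t),C(s))\le L(s-t)$ for all $0\le t<s$, then $y=\mathrm{Sw}(C,y_0)$ exists and is Lipschitz continuous on $[0,\infty)$ with constant at most $L$. -/

import Mathlib

open Set Filter Topology MeasureTheory
open scoped ENNReal NNReal

namespace Sweeping

noncomputable section

section ProxRegular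

variable {H : Type*} [NormedAddCommGroup H] [InnerProductSpace ℝ H]

/-- The set of nearest points `Proj_Z(y) = {x ∈ Z : ‖x - y‖ = d(y, Z)}`. -/
def proj (Z : Set H) (y : H) : Set H :=
  {x | x ∈ Z ∧ ‖x - y‖ = Metric.infDist y Z}

/-- The (exterior proximal) normal cone of `K` at `x`. -/
def normalCone (K : Set H) (x : H) : Set H :=
  {u | ∃ (y : H) (c : ℝ), 0 ≤ c ∧ x ∈ proj K y ∧ u = c • (y - x)}

/-- `K` is a (nonempty, closed) `r`-prox-regular set. -/
structure IsProxRegular (r : ℝ) (K : Set H) : Prop where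
  nonempty : K.Nonempty
  isClosed : IsClosed K
  proj_nonempty : ∀ y : H, 0 < Metric.infDist y K → Metric.infDist y K < r → (proj K y).Nonempty
  mem_proj : ∀ y : H, 0 < Metric.infDist y K → Metric.infDist y K < r →
    ∀ x ∈ proj K y, x ∈ proj K (x + r • (‖y - x‖⁻¹ • (y - x)))

end ProxRegular

section Retraction

variable {H : Type*} [NormedAddCommGroup H]

/-- The excess `e(Z₁, Z₂) = sup_{z ∈ Z₁} d(z, Z₂) ∈ [0, ∞]`, with `e(∅, Z) = 0` and
`e(Z, ∅) = ∞` for nonempty `Z`. -/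
def excess (Z₁ Z₂ : Set H) : ℝ≥0∞ :=
  ⨆ z ∈ Z₁, Metric.infEDist z Z₂

/-- The retraction `ret(C, J)`: the supremum of the sums `∑ e(C(t_j), C(t_{j+1}))` over finite
increasing families of points of `J`. As in Mathlib's `eVariationOn`, a family is a monotone
sequence of which the first `n + 1` terms are used; repeated points contribute `e(Z, Z) = 0`. -/
def retraction (C : ℝ → Set H) (J : Set ℝ) : ℝ≥0∞ :=
  ⨆ p : ℕ × { u : ℕ → ℝ // Monotone u ∧ ∀ i, u i ∈ J },
    ∑ i ∈ Finset.range p.1, excess (C (p.2.1 i)) (C (p.2.1 (i + 1)))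

/-- `C(t+)` for a set-valued map on `[0, ∞)`. -/
def rightLimSet (C : ℝ → Set H) (t : ℝ) : Set H :=
  {x | Tendsto (fun s => Metric.infEDist x (C s)) (𝓝[>] t) (𝓝 0)}

open Classical in
/-- `C(t-)` for a set-valued map on `[0, ∞)`, with the convention `C(0-) = C(0)`. -/
def leftLimSet (C : ℝ → Set H) (t : ℝ) : Set H :=
  if t = 0 then C 0
  else {x | Tendsto (fun s => Metric.infEDist x (C s)) (𝓝[<] t) (𝓝 0)}

/-- The class `BR^r_loc([0, ∞); C_r(H))`: the values are `r`-prox-regular, the retraction is finite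
on compact subintervals of `[0, ∞)`, and `e(C(t), C(t+)) = 0` for every `t ≥ 0`.
Only the restriction of `C` to `[0, ∞)` matters. -/
structure IsBRLocRight [InnerProductSpace ℝ H] (r : ℝ) (C : ℝ → Set H) : Prop where
  proxRegular : ∀ t, 0 ≤ t → IsProxRegular r (C t)
  retraction_lt_top : ∀ a b, 0 ≤ a → a ≤ b → retraction C (Icc a b) < ∞
  rightContinuous : ∀ t, 0 ≤ t → excess (C t) (rightLimSet C t) = 0

/-- The class `C⁰BR_loc([0, ∞); C_r(H))`. -/
structure IsContBRLoc [InnerProductSpace ℝ H] (r : ℝ) (C : ℝ → Set H) : Prop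
    extends IsBRLocRight r C where
  leftContinuous : ∀ t, 0 ≤ t → excess (leftLimSet C t) (C t) = 0

end Retraction

section Solutions

variable {H : Type*} [NormedAddCommGroup H] [InnerProductSpace ℝ H]

/-- The extension to `ℝ` of a function on `[0, ∞)`, constant on `(-∞, 0]`. -/
def extendHalfLine (y : ℝ → H) : ℝ → H := fun t => y (max 0 t)

/-- The extension to `ℝ` of a function on `[0, T]`, constant on both sides. -/
def extendIcc (T : ℝ) (y : ℝ → H) : ℝ → H := fun t => y (max 0 (min t T))

/-- `D f = v μ` for a function `f : ℝ → H` that is locally of bounded variation and `v` that is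
locally integrable for `μ`: the vector measure `v μ` is the differential (Lebesgue-Stieltjes)
measure of `f`, that is the one which takes the values given by the one-sided limits of `f` on
bounded intervals. -/
def IsDifferentialMeasure (f : ℝ → H) (v : ℝ → H) (μ : Measure ℝ) : Prop :=
  ∀ c d : ℝ, c < d →
    ∫ t in Ioo c d, v t ∂μ = Function.leftLim f d - Function.rightLim f c ∧
    ∫ t in Icc c d, v t ∂μ = Function.rightLim f d - Function.leftLim f c ∧
    ∫ t in Ico c d, v t ∂μ = Function.leftLim f d - Function.leftLim f c ∧
    ∫ t in Ioc c d, v t ∂μ = Function.rightLim f d - Function.rightLim f c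

/-- `y` solves the sweeping process on `[0, ∞)` driven by `C` with initial datum `y₀`, in the
sense of differential measures: `y` is right-continuous and locally of bounded variation,
`y(t) ∈ C(t)`, `D y = v μ` with `v ∈ L¹_loc(μ; H)` and `v(t) ∈ -N_{C(t)}(y(t))` for `μ`-a.e. `t`,
and `y(0) = P_{C(0)}(y₀)`. Only the restriction of `y` to `[0, ∞)` matters. -/
structure IsSweepingSolution (C : ℝ → Set H) (y₀ : H) (y : ℝ → H) : Prop where
  locallyBV : LocallyBoundedVariationOn y (Ici 0)
  rightContinuous : ∀ t, 0 ≤ t → ContinuousWithinAt y (Ici t) t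
  mem : ∀ t, 0 ≤ t → y t ∈ C t
  inclusion : ∃ (μ : Measure ℝ) (v : ℝ → H),
    LocallyIntegrableOn v (Ici 0) μ ∧
    IsDifferentialMeasure (extendHalfLine y) v (μ.restrict (Ici 0)) ∧
    ∀ᵐ t ∂(μ.restrict (Ici 0)), -v t ∈ normalCone (C t) (y t)
  initial : proj (C 0) y₀ = {y 0}

/-- All jumps `‖y(t) - y(t-)‖`, `t > 0`, are smaller than `r`. -/
def JumpsLT (r : ℝ) (y : ℝ → H) : Prop :=
  ∀ t, 0 < t → ‖y t - Function.leftLim y t‖ < r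

/-- `y = Sw(C, y₀)`: `y` solves the sweeping process driven by `C` with initial datum `y₀`, its
variation is controlled by the retraction of `C`, and it is the only solution on `[0, ∞)` whose
jumps are all smaller than `r`. (The restriction on the jumps cannot be dropped: for the constant
`r`-prox-regular set `{a, b}` with `‖a - b‖ = 2r`, a jump from `a` to `b` at any time
also solves the process.) -/
structure IsSw (r : ℝ) (C : ℝ → Set H) (y₀ : H) (y : ℝ → H) : Prop where
  solution : IsSweepingSolution C y₀ y
  jumps : JumpsLT r y
  unique : ∀ z : ℝ → H, IsSweepingSolution C y₀ z → JumpsLT r z → EqOn z y (Ici 0)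
  variation_le : ∀ s t, 0 ≤ s → s < t → eVariationOn y (Icc s t) ≤ retraction C (Icc s t)

/-- `y ∈ W^{1,1}([0, T]; H)`: `y` is continuous on `[0, T]` and `D y = g 𝓛¹` with `g ∈ L¹`. -/
def MemW11 (T : ℝ) (y : ℝ → H) : Prop :=
  ContinuousOn y (Icc 0 T) ∧
  ∃ g : ℝ → H, IntegrableOn g (Icc 0 T) ∧
    IsDifferentialMeasure (extendIcc T y) g (volume.restrict (Icc 0 T))

end Solutions

end

end Sweeping

/-!
The solution is constructed by the catching-up algorithm, with all estimates expressed through a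
*clock*: a continuous monotone function `m` such that the excess of `C s` over `C t` is at most
`m t - m s` for `s ≤ t` (`HasClock`). For a continuous moving set the accumulated retraction
`retClock C` is a clock; its continuity (`continuous_retClock`) is where the conditions on `C(t+)`
and `C(t-)` and the completeness of the space are used. For an absolutely continuous moving set
`∫₀ᵗ |α'|` is another one.

Everything rests on an integrated form of the inclusion `-v ∈ N_C(y)`: if `y` moves by at most
`M = m t - m s` between `s` and `t`, then
`⟪y s - y t, x - y s⟫ ≤ M * ((‖x - y s‖ + 2 * M) ^ 2 / (2 * r) + 2 * M)` for all `x ∈ C s`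
(`StepIneq`). It holds for the catching-up sequence, because projections yield normals, normals to
prox-regular sets are hypomonotone, and points of `C s` are within `M` of the later sets; it holds
for a continuous solution by integration against its differential measure. Testing two
trajectories against each other gives a one-step estimate (`StepIneq.compare`), and a discrete
Gronwall argument (`norm_sub_sq_le_of_stepIneq`) then shows both that the dyadic catching-up
trajectories are uniformly Cauchy on bounded intervals and that solutions are unique. A solution
with jumps smaller than `r` is continuous, since a jump would be a normal vector of length less
than `r` with both end points in the set (`IsSweepingSolution.tendsto_left`).

The density of the limit `y` with respect to the measure with distribution function `m` is found
without differentiating `y`. The catching-up velocities lie, up to an error tending to zero, in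
closed convex subsets of `L²` that express the variational inequality pointwise and the identity
`∫ v = y t - y 0`; a decreasing sequence of bounded closed convex sets in a Hilbert space has a
common element (`nonempty_iInter_of_convex`), and any common element is a density with values in
the opposite of the normal cone.

The bound of the variation by the retraction comes from the clock `retClock C`, and it gives the
Lipschitz estimate. In the absolutely continuous case the clock `∫₀ᵗ |α'|` produces a solution with
a Lebesgue density; by uniqueness it is the same solution, and the Lebesgue differentiation theorem
turns the density into the derivative.
-/

namespace Sweeping

/-! ### Prox-regular sets -/

section Prox

lemma mem_proj_self {H : Type*} [NormedAddCommGroup H] {K : Set H} {p : H}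
    (hp : p ∈ K) : p ∈ proj K p :=
  ⟨hp, by rw [sub_self, norm_zero, Metric.infDist_zero_of_mem hp]⟩

variable {H : Type*} [NormedAddCommGroup H] [InnerProductSpace ℝ H]

lemma inner_le_of_norm_le_norm_sub {w v : H} (h : ‖v‖ ≤ ‖w - v‖) :
    2 * inner ℝ v w ≤ ‖w‖ ^ 2 := by
  have h1 := norm_sub_sq_real w v
  have h2 : ‖v‖ ^ 2 ≤ ‖w - v‖ ^ 2 := by gcongr
  rw [real_inner_comm] at h1
  linarith

/-- Proximal normals to an `r`-prox-regular set satisfy the hypomonotonicity inequality. -/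
lemma IsProxRegular.inner_le {r : ℝ} (hr : 0 < r) {K : Set H} (hK : IsProxRegular r K)
    {p u x : H} (hu : u ∈ normalCone K p) (hx : x ∈ K) :
    inner ℝ u (x - p) ≤ ‖u‖ / (2 * r) * ‖x - p‖ ^ 2 := by
  obtain ⟨y, c, hc, hp, rfl⟩ := hu
  rcases eq_or_ne y p with rfl | hne
  · simp
  have hn : 0 < ‖y - p‖ := norm_pos_iff.2 (sub_ne_zero.2 hne)
  have hd : Metric.infDist y K = ‖y - p‖ := by rw [← hp.2, norm_sub_rev]
  rw [inner_smul_left, norm_smul, Real.norm_of_nonneg hc]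
  simp only [conj_trivial]
  have key : inner ℝ (y - p) (x - p) ≤ ‖y - p‖ / (2 * r) * ‖x - p‖ ^ 2 := by
    rcases lt_or_ge ‖y - p‖ r with hlt | hge
    · have h1 := hK.mem_proj y (by rw [hd]; exact hn) (by rw [hd]; exact hlt) p hp
      have hnv : ‖r • (‖y - p‖⁻¹ • (y - p))‖ = r := by
        rw [norm_smul, norm_smul, norm_inv, norm_norm, inv_mul_cancel₀ hn.ne', mul_one,
          Real.norm_of_nonneg hr.le]
      have h2 : ‖r • (‖y - p‖⁻¹ • (y - p))‖ ≤ ‖(x - p) - r • (‖y - p‖⁻¹ • (y - p))‖ := by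
        have h3 := h1.2
        have h4 := Metric.infDist_le_dist_of_mem (x := p + r • (‖y - p‖⁻¹ • (y - p))) hx
        rw [← h3, dist_eq_norm, norm_sub_rev] at h4
        rw [sub_sub]
        rw [norm_sub_rev _ x] at h4
        calc _ = ‖p - (p + r • (‖y - p‖⁻¹ • (y - p)))‖ := by
              rw [← norm_neg]; congr 1; abel
          _ ≤ _ := by rw [norm_sub_rev p]; exact h4
      have h5 := inner_le_of_norm_le_norm_sub h2
      rw [inner_smul_left, inner_smul_left] at h5
      simp only [conj_trivial] at h5
      have h6 : r * (‖y - p‖⁻¹ * inner ℝ (y - p) (x - p)) * ‖y - p‖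
          = r * inner ℝ (y - p) (x - p) := by field_simp
      have h7 : 2 * (r * inner ℝ (y - p) (x - p)) ≤ ‖x - p‖ ^ 2 * ‖y - p‖ := by
        rw [← h6]; nlinarith
      rw [div_mul_eq_mul_div, le_div_iff₀ (by positivity)]
      linarith
    · have h2 : ‖y - p‖ ≤ ‖(x - p) - (y - p)‖ := by
        have h4 := Metric.infDist_le_dist_of_mem (x := y) hx
        rw [hd, dist_eq_norm, norm_sub_rev] at h4
        rwa [sub_sub_sub_cancel_right, norm_sub_rev y p, norm_sub_rev x y]
      have h5 := inner_le_of_norm_le_norm_sub h2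
      rw [div_mul_eq_mul_div, le_div_iff₀ (by positivity)]
      nlinarith [sq_nonneg ‖x - p‖]
  calc c * inner ℝ (y - p) (x - p) ≤ c * (‖y - p‖ / (2 * r) * ‖x - p‖ ^ 2) := by gcongr
    _ = _ := by ring

lemma zero_mem_normalCone {K : Set H} {p : H} (hp : p ∈ K) : (0 : H) ∈ normalCone K p :=
  ⟨p, 0, le_rfl, mem_proj_self hp, by simp⟩

lemma smul_mem_normalCone {K : Set H} {p u : H} {c : ℝ} (hc : 0 ≤ c)
    (hu : u ∈ normalCone K p) : c • u ∈ normalCone K p := by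
  obtain ⟨y, d, hd, hp, rfl⟩ := hu
  exact ⟨y, c * d, mul_nonneg hc hd, hp, smul_smul _ _ _⟩

lemma sub_mem_normalCone {K : Set H} {p y : H} (hp : p ∈ proj K y) : y - p ∈ normalCone K p :=
  ⟨y, 1, zero_le_one, hp, by simp⟩

/-- A vector satisfying the hypomonotonicity inequality of the unit ball is a proximal normal. -/
lemma mem_normalCone_of_inner_le {r : ℝ} (hr : 0 < r) {K : Set H} {p u : H} (hp : p ∈ K)
    (h : ∀ x ∈ K, inner ℝ u (x - p) ≤ ‖x - p‖ ^ 2 / (2 * r)) : u ∈ normalCone K p := by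
  refine ⟨p + r • u, r⁻¹, by positivity, ⟨hp, ?_⟩, ?_⟩
  · apply le_antisymm _ (by
      rw [← dist_eq_norm, dist_comm]; exact Metric.infDist_le_dist_of_mem hp)
    rw [Metric.le_infDist ⟨p, hp⟩]
    intro x hx
    have h1 := h x hx
    rw [le_div_iff₀ (by positivity)] at h1
    rw [dist_eq_norm, norm_sub_rev _ x, ← sub_sub x, sub_add_cancel_left, norm_neg]
    apply le_of_sq_le_sq _ (norm_nonneg _)
    rw [norm_sub_sq_real (x - p), inner_smul_right, real_inner_comm]
    linarith
  · rw [add_sub_cancel_left, smul_smul, inv_mul_cancel₀ hr.ne', one_smul]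

/-- Points at distance less than `r` from an `r`-prox-regular set have exactly one projection. -/
lemma IsProxRegular.exists_proj_eq_singleton {r : ℝ} (hr : 0 < r) {K : Set H}
    (hK : IsProxRegular r K) {y : H} (hy : Metric.infDist y K < r) : ∃ p, proj K y = {p} := by
  have hne : (proj K y).Nonempty := by
    rcases (Metric.infDist_nonneg (x := y) (s := K)).eq_or_lt with h0 | h0
    · exact ⟨y, mem_proj_self ((hK.isClosed.mem_iff_infDist_zero hK.nonempty).2 h0.symm)⟩
    · exact hK.proj_nonempty y h0 hy
  obtain ⟨p, hp⟩ := hne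
  refine ⟨p, Subset.antisymm (fun q hq => ?_) (singleton_subset_iff.2 hp)⟩
  have h1 := hK.inner_le hr (sub_mem_normalCone hp) hq.1
  have h2 := hK.inner_le hr (sub_mem_normalCone hq) hp.1
  rw [norm_sub_rev y p, hp.2] at h1
  rw [norm_sub_rev y q, hq.2, norm_sub_rev p q] at h2
  have h3 : inner ℝ (y - p) (q - p) + inner ℝ (y - q) (p - q) = ‖q - p‖ ^ 2 := by
    rw [← neg_sub q p, inner_neg_right, ← sub_eq_add_neg, ← inner_sub_left,
      sub_sub_sub_cancel_left, real_inner_self_eq_norm_sq]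
  have h4 : ‖q - p‖ ^ 2 * (1 - Metric.infDist y K / r) ≤ 0 := by
    have : Metric.infDist y K / (2 * r) + Metric.infDist y K / (2 * r)
      = Metric.infDist y K / r := by field_simp; ring
    nlinarith
  have h5 : 0 < 1 - Metric.infDist y K / r := by
    rw [sub_pos, div_lt_one hr]; exact hy
  have h6 : ‖q - p‖ ^ 2 ≤ 0 := by
    by_contra! h; nlinarith
  have h7 : ‖q - p‖ = 0 := by
    have := sq_nonneg ‖q - p‖
    exact pow_eq_zero_iff (two_ne_zero) |>.1 (le_antisymm h6 this)
  exact sub_eq_zero.1 (norm_eq_zero.1 h7)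

/-- The bound appearing in the variational inequalities: a prox-regularity term for a test point
at distance `d`, with base point and test point both perturbed by at most `M`. -/
noncomputable def bracket (r d M : ℝ) : ℝ := (d + 2 * M) ^ 2 / (2 * r) + 2 * M

lemma bracket_nonneg {r d M : ℝ} (hr : 0 < r) (hM : 0 ≤ M) : 0 ≤ bracket r d M := by
  unfold bracket; positivity

lemma bracket_mono {r d d' M M' : ℝ} (hr : 0 < r) (hd : 0 ≤ d) (hdd : d ≤ d') (hM : 0 ≤ M)
    (hMM : M ≤ M') : bracket r d M ≤ bracket r d' M' := by
  unfold bracket; gcongr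

/-- The hypomonotonicity inequality is stable under perturbation of the base point and of the
test point, which need not belong to the set. -/
lemma IsProxRegular.inner_le_bracket {r : ℝ} (hr : 0 < r) {K : Set H} (hK : IsProxRegular r K)
    {p q u x : H} {M : ℝ} (hu : u ∈ normalCone K p) (hx : Metric.infDist x K ≤ M)
    (hq : ‖p - q‖ ≤ M) : inner ℝ u (x - q) ≤ ‖u‖ * bracket r ‖x - q‖ M := by
  have hM : 0 ≤ M := (norm_nonneg _).trans hq
  have key : ∀ ε > 0, inner ℝ u (x - q) ≤ ‖u‖ * bracket r ‖x - q‖ (M + ε) := by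
    intro ε hε
    obtain ⟨x', hx', hd⟩ := (Metric.infDist_lt_iff hK.nonempty).1
      (lt_of_le_of_lt hx (lt_add_of_pos_right M hε))
    rw [dist_eq_norm] at hd
    have h1 := hK.inner_le hr hu hx'
    have e : x - q = (x' - p) + (x - x') + (p - q) := by abel
    have h2 : inner ℝ u (x - x') ≤ ‖u‖ * (M + ε) :=
      (real_inner_le_norm _ _).trans (by gcongr)
    have h3 : inner ℝ u (p - q) ≤ ‖u‖ * (M + ε) :=
      (real_inner_le_norm _ _).trans (by gcongr; linarith)
    have h4 : ‖x' - p‖ ≤ ‖x - q‖ + 2 * (M + ε) := by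
      have : x' - p = (x - q) - (x - x') - (p - q) := by abel
      rw [this]
      have := norm_sub_le ((x - q) - (x - x')) (p - q)
      have := norm_sub_le (x - q) (x - x')
      linarith
    calc inner ℝ u (x - q) = inner ℝ u (x' - p) + inner ℝ u (x - x') + inner ℝ u (p - q) := by
          conv_lhs => rw [e, inner_add_right, inner_add_right]
      _ ≤ ‖u‖ / (2 * r) * (‖x - q‖ + 2 * (M + ε)) ^ 2 + ‖u‖ * (M + ε) + ‖u‖ * (M + ε) := by
          have : ‖u‖ / (2 * r) * ‖x' - p‖ ^ 2 ≤ ‖u‖ / (2 * r) * (‖x - q‖ + 2 * (M + ε)) ^ 2 := by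
            gcongr
          linarith
      _ = _ := by unfold bracket; ring
  have hc : Tendsto (fun ε : ℝ => ‖u‖ * bracket r ‖x - q‖ (M + ε)) (𝓝[>] 0)
      (𝓝 (‖u‖ * bracket r ‖x - q‖ M)) := by
    have : Continuous fun ε : ℝ => ‖u‖ * bracket r ‖x - q‖ (M + ε) := by
      unfold bracket; fun_prop
    have h := (this.tendsto 0).mono_left (nhdsWithin_le_nhds (s := Ioi 0))
    simpa using h
  exact ge_of_tendsto hc (eventually_nhdsWithin_of_forall key)

end Prox

/-! ### The retraction as a clock -/

section Clock

variable {H : Type*} [NormedAddCommGroup H]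

lemma infEDist_le_infEDist_add_excess (x : H) (A B : Set H) :
    Metric.infEDist x B ≤ Metric.infEDist x A + excess A B := by
  rcases A.eq_empty_or_nonempty with rfl | hA
  · simp
  conv_rhs => rw [Metric.infEDist, ENNReal.iInf_add]
  refine le_iInf fun z => ?_
  by_cases hz : z ∈ A
  · simp only [hz, iInf_pos]
    calc Metric.infEDist x B ≤ edist x z + Metric.infEDist z B :=
          Metric.infEDist_le_edist_add_infEDist
      _ ≤ _ := by
          gcongr
          exact le_iSup₂ (f := fun z _ => Metric.infEDist z B) z hz
  · simp [hz]

lemma infEDist_le_excess {x : H} {A : Set H} (hx : x ∈ A) (B : Set H) :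
    Metric.infEDist x B ≤ excess A B :=
  le_iSup₂ (f := fun z _ => Metric.infEDist z B) x hx

lemma excess_self (A : Set H) : excess A A = 0 := by
  simp only [excess, ENNReal.iSup_eq_zero]
  exact fun x hx => Metric.infEDist_zero_of_mem hx

lemma excess_triangle (A B D : Set H) : excess A D ≤ excess A B + excess B D :=
  iSup₂_le fun _ hx => (infEDist_le_infEDist_add_excess _ B D).trans
    (add_le_add_left (infEDist_le_excess hx B) _)

lemma infDist_le_of_excess_le {x : H} {A B : Set H} (hx : x ∈ A) {M : ℝ} (hM : 0 ≤ M)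
    (h : excess A B ≤ ENNReal.ofReal M) : Metric.infDist x B ≤ M :=
  ENNReal.toReal_le_of_le_ofReal hM ((infEDist_le_excess hx B).trans h)

lemma sum_excess_le_retraction {C : ℝ → Set H} {J : Set ℝ} {u : ℕ → ℝ} (hu : Monotone u)
    (hJ : ∀ i, u i ∈ J) (n : ℕ) :
    ∑ i ∈ Finset.range n, excess (C (u i)) (C (u (i + 1))) ≤ retraction C J :=
  le_iSup (fun p : ℕ × { u : ℕ → ℝ // Monotone u ∧ ∀ i, u i ∈ J } =>
    ∑ i ∈ Finset.range p.1, excess (C (p.2.1 i)) (C (p.2.1 (i + 1)))) (n, ⟨u, hu, hJ⟩)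

lemma retraction_mono {C : ℝ → Set H} {J J' : Set ℝ} (h : J ⊆ J') :
    retraction C J ≤ retraction C J' :=
  iSup_le fun p => sum_excess_le_retraction p.2.2.1 (fun i => h (p.2.2.2 i)) p.1

/-- Telescoping: if `g` dominates all excesses, it dominates the retraction. -/
lemma add_sum_excess_le {C : ℝ → Set H} {J : Set ℝ} {g : ℝ → ℝ≥0∞}
    (hg : ∀ s ∈ J, ∀ t ∈ J, s ≤ t → g s + excess (C s) (C t) ≤ g t)
    {u : ℕ → ℝ} (hu : Monotone u) (hJ : ∀ i, u i ∈ J) (n : ℕ) :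
    g (u 0) + ∑ i ∈ Finset.range n, excess (C (u i)) (C (u (i + 1))) ≤ g (u n) := by
  induction n with
  | zero => simp
  | succ n ih =>
    rw [Finset.sum_range_succ, ← add_assoc]
    exact (add_le_add_left ih _).trans (hg _ (hJ n) _ (hJ (n + 1)) (hu n.le_succ))

lemma add_retraction_le {C : ℝ → Set H} {a b : ℝ} (hab : a ≤ b) {g : ℝ → ℝ≥0∞}
    (hg : ∀ s ∈ Icc a b, ∀ t ∈ Icc a b, s ≤ t → g s + excess (C s) (C t) ≤ g t) :
    g a + retraction C (Icc a b) ≤ g b := by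
  have hmono : ∀ s ∈ Icc a b, ∀ t ∈ Icc a b, s ≤ t → g s ≤ g t :=
    fun s hs t ht hst => le_self_add.trans (hg s hs t ht hst)
  have : Nonempty (ℕ × { u : ℕ → ℝ // Monotone u ∧ ∀ i, u i ∈ Icc a b }) :=
    ⟨0, fun _ => a, monotone_const, fun _ => left_mem_Icc.2 hab⟩
  rw [retraction, ENNReal.add_iSup]
  refine iSup_le fun p => ?_
  obtain ⟨n, u, hu, hJ⟩ := p
  calc _ ≤ g (u 0) + ∑ i ∈ Finset.range n, excess (C (u i)) (C (u (i + 1))) :=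
        add_le_add_left (hmono _ (left_mem_Icc.2 hab) _ (hJ 0) (hJ 0).1) _
    _ ≤ g (u n) := add_sum_excess_le hg hu hJ n
    _ ≤ g b := hmono _ (hJ n) _ (right_mem_Icc.2 hab) (hJ n).2

lemma retraction_add_excess_le {C : ℝ → Set H} {a s t : ℝ} (has : a ≤ s) (hst : s ≤ t) :
    retraction C (Icc a s) + excess (C s) (C t) ≤ retraction C (Icc a t) := by
  have : Nonempty (ℕ × { u : ℕ → ℝ // Monotone u ∧ ∀ i, u i ∈ Icc a s }) :=
    ⟨0, fun _ => a, monotone_const, fun _ => left_mem_Icc.2 has⟩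
  rw [retraction, ENNReal.iSup_add]
  refine iSup_le fun p => ?_
  obtain ⟨n, u, hu, hJ⟩ := p
  -- follow `u` for `n` steps, then jump to `s` and to `t`
  let w : ℕ → ℝ := fun i => if i ≤ n then u i else if i = n + 1 then s else t
  have hw : Monotone w := by
    refine monotone_nat_of_le_succ fun i => ?_
    have h1 := hu i.le_succ
    have h2 := (hJ i).2
    simp only [w]
    split_ifs <;> first | assumption | omega | exact le_rfl
  have hwJ : ∀ i, w i ∈ Icc a t := by
    intro i
    simp only [w]
    split_ifs
    · exact ⟨(hJ i).1, (hJ i).2.trans hst⟩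
    · exact ⟨has, hst⟩
    · exact ⟨has.trans hst, le_rfl⟩
  refine le_trans ?_ (sum_excess_le_retraction hw hwJ (n + 2))
  rw [Finset.sum_range_succ, Finset.sum_range_succ]
  have h1 : w (n + 1) = s := by simp [w]
  have h2 : w (n + 1 + 1) = t := by simp [w]
  rw [h1, h2]
  gcongr
  refine le_trans (Finset.sum_le_sum fun i hi => ?_) le_self_add
  have hi' := Finset.mem_range.1 hi
  simp only [w]
  rw [if_pos hi'.le, if_pos (by omega)]

lemma retraction_Icc_add_Icc (C : ℝ → Set H) {a b c : ℝ} (hab : a ≤ b) (hbc : b ≤ c) :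
    retraction C (Icc a b) + retraction C (Icc b c) = retraction C (Icc a c) := by
  apply le_antisymm
  · exact add_retraction_le (g := fun t => retraction C (Icc a t)) hbc
      fun s hs t _ hst => retraction_add_excess_le (hab.trans hs.1) hst
  · -- the accumulated cost of going through `b`
    let g : ℝ → ℝ≥0∞ := fun t => if t ≤ b then retraction C (Icc a t)
      else retraction C (Icc a b) + retraction C (Icc b t)
    have h := add_retraction_le (C := C) (g := g) (hab.trans hbc) ?_
    · have hgc : g c ≤ retraction C (Icc a b) + retraction C (Icc b c) := by
        simp only [g]
        split_ifs with hc
        · exact (retraction_mono (Icc_subset_Icc_right hc)).trans le_self_add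
        · exact le_rfl
      exact le_add_self.trans (h.trans hgc)
    · intro s hs t ht hst
      simp only [g]
      by_cases htb : t ≤ b
      · rw [if_pos (hst.trans htb), if_pos htb]
        exact retraction_add_excess_le hs.1 hst
      · rw [if_neg htb]
        have hbt := (not_le.1 htb).le
        by_cases hsb : s ≤ b
        · rw [if_pos hsb]
          calc _ ≤ retraction C (Icc a s) + (excess (C s) (C b) + excess (C b) (C t)) := by
                gcongr; exact excess_triangle _ _ _
            _ = (retraction C (Icc a s) + excess (C s) (C b)) + excess (C b) (C t) := by
                rw [add_assoc]
            _ ≤ _ := by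
                gcongr
                · exact retraction_add_excess_le hs.1 hsb
                · exact le_add_self.trans (retraction_add_excess_le (le_refl b) hbt)
        · rw [if_neg hsb, add_assoc]
          gcongr
          exact retraction_add_excess_le (not_le.1 hsb).le hst

/-- The retraction accumulated on `[0, t]`, as a real number; it vanishes for `t ≤ 0`. -/
noncomputable def retClock (C : ℝ → Set H) (t : ℝ) : ℝ := (retraction C (Icc 0 t)).toReal

lemma retClock_zero (C : ℝ → Set H) : retClock C 0 = 0 := by
  have h := add_retraction_le (C := C) (a := 0) (b := 0) le_rfl (g := fun _ => 0) (by
    intro s hs t ht hst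
    have h1 : s = t := by
      have := hs.1; have := hs.2; have := ht.1; have := ht.2; linarith
    simp [h1, excess_self])
  rw [zero_add, nonpos_iff_eq_zero] at h
  rw [retClock, h, ENNReal.toReal_zero]

lemma retClock_of_nonpos (C : ℝ → Set H) {t : ℝ} (ht : t ≤ 0) : retClock C t = 0 := by
  rcases ht.eq_or_lt with rfl | ht
  · exact retClock_zero C
  have : IsEmpty (ℕ × { u : ℕ → ℝ // Monotone u ∧ ∀ i, u i ∈ Icc 0 t }) := by
    refine ⟨fun p => ?_⟩
    have := p.2.2.2 0
    exact (this.1.trans this.2).not_gt ht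
  simp [retClock, retraction]

lemma retClock_nonneg (C : ℝ → Set H) (t : ℝ) : 0 ≤ retClock C t := ENNReal.toReal_nonneg

lemma retClock_add {C : ℝ → Set H}
    (hfin : ∀ a b, 0 ≤ a → a ≤ b → retraction C (Icc a b) < ∞)
    {s t : ℝ} (hs : 0 ≤ s) (hst : s ≤ t) :
    retClock C s + (retraction C (Icc s t)).toReal = retClock C t := by
  rw [retClock, retClock, ← retraction_Icc_add_Icc C hs hst,
    ENNReal.toReal_add (hfin _ _ le_rfl hs).ne (hfin _ _ hs hst).ne]

lemma retraction_Icc_eq {C : ℝ → Set H}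
    (hfin : ∀ a b, 0 ≤ a → a ≤ b → retraction C (Icc a b) < ∞)
    {s t : ℝ} (hs : 0 ≤ s) (hst : s ≤ t) :
    retraction C (Icc s t) = ENNReal.ofReal (retClock C t - retClock C s) := by
  rw [← retClock_add hfin hs hst, add_sub_cancel_left, ENNReal.ofReal_toReal (hfin _ _ hs hst).ne]

lemma monotone_retClock {C : ℝ → Set H}
    (hfin : ∀ a b, 0 ≤ a → a ≤ b → retraction C (Icc a b) < ∞) : Monotone (retClock C) := by
  intro s t hst
  rcases le_or_gt s 0 with hs | hs
  · rw [retClock_of_nonpos C hs]; exact retClock_nonneg C t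
  · rw [← retClock_add hfin hs.le hst]
    exact le_add_of_nonneg_right ENNReal.toReal_nonneg

lemma excess_le_retClock {C : ℝ → Set H}
    (hfin : ∀ a b, 0 ≤ a → a ≤ b → retraction C (Icc a b) < ∞)
    {s t : ℝ} (hs : 0 ≤ s) (hst : s ≤ t) :
    excess (C s) (C t) ≤ ENNReal.ofReal (retClock C t - retClock C s) := by
  rw [← retraction_Icc_eq hfin hs hst]
  exact le_add_self.trans (retraction_add_excess_le (le_refl s) hst)

/-- Every monotone function whose increments dominate the excesses has larger increments than the
accumulated retraction. -/
lemma retClock_sub_le {C : ℝ → Set H}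
    (hfin : ∀ a b, 0 ≤ a → a ≤ b → retraction C (Icc a b) < ∞)
    {g : ℝ → ℝ} {a b : ℝ} (ha : 0 ≤ a) (hab : a ≤ b)
    (hmono : MonotoneOn g (Icc a b))
    (hg : ∀ s ∈ Icc a b, ∀ t ∈ Icc a b, s < t →
      excess (C s) (C t) ≤ ENNReal.ofReal (g t - g s)) :
    retClock C b - retClock C a ≤ g b - g a := by
  have h := add_retraction_le (C := C) hab (g := fun t => ENNReal.ofReal (g t - g a)) (by
    intro s hs t ht hst
    have h1 : excess (C s) (C t) ≤ ENNReal.ofReal (g t - g s) := by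
      rcases hst.eq_or_lt with rfl | h
      · simp [excess_self]
      · exact hg s hs t ht h
    calc _ ≤ ENNReal.ofReal (g s - g a) + ENNReal.ofReal (g t - g s) := by gcongr
      _ = _ := by
        rw [← ENNReal.ofReal_add]
        · congr 1; ring
        · exact sub_nonneg.2 (hmono (left_mem_Icc.2 hab) hs hs.1)
        · exact sub_nonneg.2 (hmono hs ht hst))
  rw [retraction_Icc_eq hfin ha hab] at h
  have h2 := le_add_self.trans h
  exact (ENNReal.ofReal_le_ofReal_iff (sub_nonneg.2
    (hmono (left_mem_Icc.2 hab) (right_mem_Icc.2 hab) hab))).1 h2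

/-- The accumulated retraction is right continuous at `t`: leaving `C t` towards `C s`, `t < s`,
costs only the retraction on `(t, s]`, since points of `C t` are limits of points of the later
sets. -/
lemma rightLim_retClock_le {C : ℝ → Set H}
    (hfin : ∀ a b, 0 ≤ a → a ≤ b → retraction C (Icc a b) < ∞) {t : ℝ} (ht : 0 ≤ t)
    (hC : excess (C t) (rightLimSet C t) = 0) :
    Function.rightLim (retClock C) t ≤ retClock C t := by
  have hm := monotone_retClock hfin
  set L := Function.rightLim (retClock C) t with hL
  have hlim : Tendsto (retClock C) (𝓝[>] t) (𝓝 L) := hm.tendsto_rightLim t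
  have hLle : ∀ s, t < s → L ≤ retClock C s := fun s hs => hm.rightLim_le hs
  -- step out of `t` at the cost `retClock C s - L`
  have hstep : ∀ s, t < s → excess (C t) (C s) ≤ ENNReal.ofReal (retClock C s - L) := by
    intro s hs
    have h1 : ∀ x ∈ rightLimSet C t,
        Metric.infEDist x (C s) ≤ ENNReal.ofReal (retClock C s - L) := by
      intro x hx
      have h2 : Tendsto (fun s' => Metric.infEDist x (C s')
          + ENNReal.ofReal (retClock C s - retClock C s')) (𝓝[>] t)
          (𝓝 (0 + ENNReal.ofReal (retClock C s - L))) :=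
        Tendsto.add hx (ENNReal.tendsto_ofReal (hlim.const_sub _))
      rw [zero_add] at h2
      refine ge_of_tendsto h2 ?_
      filter_upwards [Ioo_mem_nhdsGT hs] with s' hs'
      exact (infEDist_le_infEDist_add_excess x (C s') (C s)).trans
        (by gcongr; exact excess_le_retClock hfin (ht.trans hs'.1.le) hs'.2.le)
    calc excess (C t) (C s) ≤ excess (C t) (rightLimSet C t) + excess (rightLimSet C t) (C s) :=
          excess_triangle _ _ _
      _ ≤ _ := by rw [hC, zero_add]; exact iSup₂_le h1
  -- the clock modified at `t` alone still dominates the excesses, hence the retraction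
  have h := retClock_sub_le hfin (g := Function.update (retClock C) t L) (b := t + 1) ht
    (by linarith) ?_ ?_
  · rw [Function.update_self, Function.update_of_ne (by linarith)] at h
    linarith
  · intro a ha b hb hab
    rcases eq_or_ne a t with rfl | hat
    · rcases eq_or_ne b a with rfl | hbt
      · exact le_rfl
      · rw [Function.update_self, Function.update_of_ne hbt]
        exact hLle b (lt_of_le_of_ne hb.1 hbt.symm)
    · have hbt : b ≠ t := by
        rintro rfl; exact hat (le_antisymm hab ha.1)
      rw [Function.update_of_ne hat, Function.update_of_ne hbt]
      exact hm hab
  · intro a ha b hb hab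
    have hbt : b ≠ t := (ha.1.trans_lt hab).ne'
    rw [Function.update_of_ne hbt]
    rcases eq_or_ne a t with rfl | hat
    · rw [Function.update_self]; exact hstep b hab
    · rw [Function.update_of_ne hat]
      exact excess_le_retClock hfin (ht.trans ha.1) hab.le

/-- A point of `C(s)` can be followed along `C(τ)`, `τ → t-`, to a point of `C(t-)`, at a cost
that is the retraction on `[s, t)`. -/
lemma exists_mem_leftLimSet [CompleteSpace H] {C : ℝ → Set H}
    (hfin : ∀ a b, 0 ≤ a → a ≤ b → retraction C (Icc a b) < ∞) {s t : ℝ} (hs : 0 ≤ s)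
    (hst : s < t) {x : H} (hx : x ∈ C s) {ε : ℝ} (hε : 0 < ε) :
    ∃ z ∈ leftLimSet C t,
      dist x z ≤ Function.leftLim (retClock C) t - retClock C s + ε := by
  have hm := monotone_retClock hfin
  set L := Function.leftLim (retClock C) t with hL
  have hlim : Tendsto (retClock C) (𝓝[<] t) (𝓝 L) := hm.tendsto_leftLim t
  have hleL : ∀ τ, τ < t → retClock C τ ≤ L := fun τ h => hm.le_leftLim h
  -- nodes `σ n ↑ t`
  let σ : ℕ → ℝ := fun n => t - (t - s) / (n + 1)
  have hpos : 0 < t - s := sub_pos.2 hst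
  have hσlt : ∀ n, σ n < t := fun n => by
    have : 0 < (t - s) / ((n : ℝ) + 1) := by positivity
    simp only [σ]; linarith
  have hσ0 : σ 0 = s := by simp [σ]
  have hσmono : Monotone σ := by
    intro a b hab
    simp only [σ]
    gcongr
  have hσs : ∀ n, s ≤ σ n := fun n => hσ0 ▸ hσmono n.zero_le
  have hσlim : Tendsto σ atTop (𝓝 t) := by
    have h := (tendsto_one_div_add_atTop_nhds_zero_nat (𝕜 := ℝ)).const_mul (t - s)
    have h2 := h.const_sub t
    simpa [σ, div_eq_mul_inv] using h2
  have hclk : Tendsto (fun n => retClock C (σ n)) atTop (𝓝 L) :=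
    hlim.comp (tendsto_nhdsWithin_iff.2 ⟨hσlim, Eventually.of_forall hσlt⟩)
  have hpow : Tendsto (fun n : ℕ => ε / 2 ^ n) atTop (𝓝 0) := by
    have := (tendsto_pow_atTop_nhds_zero_of_lt_one (r := (1 / 2 : ℝ)) (by norm_num)
      (by norm_num)).const_mul ε
    simpa [div_eq_mul_inv] using this
  have hsum : ∀ n : ℕ, 0 < ε / 2 / 2 ^ n := fun n => by positivity
  -- near-projections from node to node, with errors summing to `ε`
  have hex : ∀ (n : ℕ) (p : H), p ∈ C (σ n) → ∃ q ∈ C (σ (n + 1)),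
      dist p q ≤ retClock C (σ (n + 1)) - retClock C (σ n) + ε / 2 / 2 ^ n := by
    intro n p hp
    have h0 : 0 ≤ retClock C (σ (n + 1)) - retClock C (σ n) :=
      sub_nonneg.2 (hm (hσmono n.le_succ))
    have h1 := (infEDist_le_excess hp (C (σ (n + 1)))).trans
      (excess_le_retClock hfin (hs.trans (hσs n)) (hσmono n.le_succ))
    have h2 : Metric.infEDist p (C (σ (n + 1))) <
        ENNReal.ofReal (retClock C (σ (n + 1)) - retClock C (σ n) + ε / 2 / 2 ^ n) :=
      h1.trans_lt ((ENNReal.ofReal_lt_ofReal_iff (by have := hsum n; linarith)).2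
        (by have := hsum n; linarith))
    obtain ⟨q, hq, hd⟩ := Metric.infEDist_lt_iff.1 h2
    refine ⟨q, hq, ?_⟩
    rw [edist_dist] at hd
    exact ((ENNReal.ofReal_lt_ofReal_iff (by have := hsum n; linarith)).1 hd).le
  choose! F hF hFd using hex
  let X : ℕ → H := fun n => Nat.rec x (fun n p => F n p) n
  have hX : ∀ n, X n ∈ C (σ n) := by
    intro n
    induction n with
    | zero => change x ∈ C (σ 0); rw [hσ0]; exact hx
    | succ n ih => exact hF n _ ih
  have hXd : ∀ n, dist (X n) (X (n + 1)) ≤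
      retClock C (σ (n + 1)) - retClock C (σ n) + ε / 2 / 2 ^ n := fun n => hFd n _ (hX n)
  have hcauchy : CauchySeq X ∧ ∀ z, Tendsto X atTop (𝓝 z) → ∀ n, dist (X n) z ≤
      L - retClock C (σ n) + ε / 2 ^ n := by
    have hbound : ∀ n k, dist (X n) (X (n + k)) ≤
        retClock C (σ (n + k)) - retClock C (σ n) + (ε / 2 ^ n - ε / 2 ^ (n + k)) := by
      intro n k
      induction k with
      | zero => simp
      | succ k ih =>
        have h1 := dist_triangle (X n) (X (n + k)) (X (n + (k + 1)))
        have h2 := hXd (n + k)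
        have h3 : ε / 2 / 2 ^ (n + k) = ε / 2 ^ (n + k) - ε / 2 ^ (n + (k + 1)) := by
          rw [← add_assoc, pow_succ]; field_simp; ring
        rw [h3] at h2
        rw [← add_assoc] at h1 h2 ⊢
        linarith
    have hb2 : ∀ n m, n ≤ m → dist (X n) (X m) ≤ L - retClock C (σ n) + ε / 2 ^ n := by
      intro n m hnm
      obtain ⟨k, rfl⟩ := Nat.exists_eq_add_of_le hnm
      have h1 := hbound n k
      have h2 := hleL _ (hσlt (n + k))
      have h3 : 0 < ε / 2 ^ (n + k) := by positivity
      linarith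
    refine ⟨?_, fun z hz n => ?_⟩
    · refine cauchySeq_of_le_tendsto_0' (fun n => L - retClock C (σ n) + ε / 2 ^ n) hb2 ?_
      simpa using (hclk.const_sub L).add hpow
    · refine le_of_tendsto (tendsto_const_nhds.dist hz) ?_
      filter_upwards [eventually_ge_atTop n] with m hnm using hb2 n m hnm
  obtain ⟨z, hz⟩ := cauchySeq_tendsto_of_complete hcauchy.1
  refine ⟨z, ?_, ?_⟩
  · rw [leftLimSet, if_neg (hs.trans_lt hst).ne']
    have hbd : ∀ n, ∀ τ, σ n ≤ τ → τ < t → Metric.infEDist z (C τ) ≤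
        ENNReal.ofReal (2 * (L - retClock C (σ n)) + ε / 2 ^ n) := by
      intro n τ h1 h2
      have h3 := hcauchy.2 z hz n
      have h5 : 0 ≤ L - retClock C (σ n) := sub_nonneg.2 (hleL _ (hσlt n))
      calc Metric.infEDist z (C τ) ≤ edist z (X n) + Metric.infEDist (X n) (C τ) :=
            Metric.infEDist_le_edist_add_infEDist
        _ ≤ ENNReal.ofReal (L - retClock C (σ n) + ε / 2 ^ n)
            + ENNReal.ofReal (L - retClock C (σ n)) := by
          gcongr
          · rw [edist_dist, dist_comm]; gcongr
          · refine (infEDist_le_excess (hX n) _).trans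
              ((excess_le_retClock hfin (hs.trans (hσs n)) h1).trans ?_)
            gcongr
            exact hleL _ h2
        _ = _ := by
          rw [← ENNReal.ofReal_add (by positivity) h5]; congr 1; ring
    have hn : Tendsto (fun n => ENNReal.ofReal (2 * (L - retClock C (σ n)) + ε / 2 ^ n)) atTop
        (𝓝 0) := by
      have h3 := ENNReal.tendsto_ofReal (((hclk.const_sub L).const_mul 2).add hpow)
      simpa using h3
    refine ENNReal.tendsto_nhds_zero.2 fun δ hδ => ?_
    obtain ⟨n, hnδ⟩ := (ENNReal.tendsto_nhds_zero.1 hn δ hδ).exists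
    filter_upwards [Ico_mem_nhdsLT (hσlt n)] with τ hτ
    exact (hbd n τ hτ.1 hτ.2).trans hnδ
  · have h := hcauchy.2 z hz 0
    rw [hσ0, pow_zero, div_one] at h
    exact h

/-- The accumulated retraction is left continuous at `t`: arriving at `C t` from `C s` costs only
the retraction on `[s, t)`. -/
lemma le_leftLim_retClock [CompleteSpace H] {C : ℝ → Set H}
    (hfin : ∀ a b, 0 ≤ a → a ≤ b → retraction C (Icc a b) < ∞) {t : ℝ} (ht : 0 < t)
    (hC : excess (leftLimSet C t) (C t) = 0) :
    retClock C t ≤ Function.leftLim (retClock C) t := by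
  have hm := monotone_retClock hfin
  set L := Function.leftLim (retClock C) t with hL
  have hleL : ∀ τ, τ < t → retClock C τ ≤ L := fun τ h => hm.le_leftLim h
  have hstep : ∀ s, 0 ≤ s → s < t → excess (C s) (C t) ≤ ENNReal.ofReal (L - retClock C s) := by
    intro s hs hst
    refine iSup₂_le fun x hx => ?_
    have h0 : 0 ≤ L - retClock C s := sub_nonneg.2 (hleL s hst)
    refine ENNReal.le_of_forall_pos_le_add fun ε hε _ => ?_
    obtain ⟨z, hz, hd⟩ := exists_mem_leftLimSet hfin hs hst hx (ε := ε) (by exact_mod_cast hε)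
    calc Metric.infEDist x (C t) ≤ edist x z + Metric.infEDist z (C t) :=
          Metric.infEDist_le_edist_add_infEDist
      _ ≤ ENNReal.ofReal (L - retClock C s + ε) + 0 := by
          gcongr
          · rw [edist_dist]; gcongr
          · exact hC ▸ infEDist_le_excess hz _
      _ = _ := by
          rw [add_zero, ENNReal.ofReal_add h0 ε.coe_nonneg, ENNReal.ofReal_coe_nnreal]
  -- the clock lowered at `t` alone still dominates the excesses on `[0, t]`
  have h := retClock_sub_le hfin (g := Function.update (retClock C) t L) (a := 0) le_rfl
    ht.le ?_ ?_
  · rw [Function.update_self, Function.update_of_ne ht.ne, retClock_zero] at h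
    linarith
  · intro a ha b hb hab
    rcases eq_or_ne b t with rfl | hbt
    · rcases eq_or_ne a b with rfl | hat
      · exact le_rfl
      · rw [Function.update_self, Function.update_of_ne hat]
        exact hleL a (lt_of_le_of_ne hab hat)
    · have hat : a ≠ t := by
        rintro rfl; exact hbt (le_antisymm hb.2 hab)
      rw [Function.update_of_ne hat, Function.update_of_ne hbt]
      exact hm hab
  · intro a ha b hb hab
    have hat : a ≠ t := (hab.trans_le hb.2).ne
    rw [Function.update_of_ne hat]
    rcases eq_or_ne b t with rfl | hbt
    · rw [Function.update_self]; exact hstep a ha.1 hab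
    · rw [Function.update_of_ne hbt]
      exact excess_le_retClock hfin ha.1 hab.le

lemma continuous_retClock [InnerProductSpace ℝ H] [CompleteSpace H] {r : ℝ} {C : ℝ → Set H}
    (hC : IsContBRLoc r C) : Continuous (retClock C) := by
  have hm := monotone_retClock hC.retraction_lt_top
  refine continuous_iff_continuousAt.2 fun t => ?_
  rcases lt_or_ge t 0 with ht | ht
  · have : retClock C =ᶠ[𝓝 t] fun _ => 0 := by
      filter_upwards [Iio_mem_nhds ht] with s hs using retClock_of_nonpos C (le_of_lt hs)
    exact continuousAt_const.congr this.symm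
  · refine (hm.continuousAt_iff_leftLim_eq_rightLim).2 (le_antisymm
      (hm.leftLim_le_rightLim le_rfl) ?_)
    refine (rightLim_retClock_le hC.retraction_lt_top ht (hC.rightContinuous t ht)).trans ?_
    rcases ht.eq_or_lt with rfl | ht0
    · have : Tendsto (retClock C) (𝓝[<] 0) (𝓝 0) := by
        refine tendsto_const_nhds.congr' ?_
        filter_upwards [self_mem_nhdsWithin] with s hs
        exact (retClock_of_nonpos C (le_of_lt hs)).symm
      rw [leftLim_eq_of_tendsto this, retClock_zero]
    · exact le_leftLim_retClock hC.retraction_lt_top ht0 (hC.leftContinuous t ht)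

end Clock

/-! ### Variational inequalities over a time step, and comparison -/

section Compare

variable {H : Type*} [NormedAddCommGroup H] [InnerProductSpace ℝ H]

/-- The integrated form of the sweeping inclusion over the time step from `s` to `t`, for a
trajectory `y` whose displacement is controlled by the clock increment `M = m t - m s`. Test
points are taken in `C s` only, since points of `C s` are close to the later sets but not
conversely. -/
structure StepIneq (r : ℝ) (C : ℝ → Set H) (m : ℝ → ℝ) (y : ℝ → H) (s t : ℝ) : Prop where
  norm_le : ‖y t - y s‖ ≤ m t - m s
  inner_le : ∀ x ∈ C s, inner ℝ (y s - y t) (x - y s) ≤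
    (m t - m s) * bracket r ‖x - y s‖ (m t - m s)

lemma StepIneq.compare {r : ℝ} (hr : 0 < r) {C : ℝ → Set H} {m : ℝ → ℝ} {y z : ℝ → H} {s t : ℝ}
    (hy : StepIneq r C m y s t) (hz : StepIneq r C m z s t) (hys : y s ∈ C s) (hzs : z s ∈ C s)
    {η : ℝ} (hη : m t - m s ≤ η) :
    ‖y t - z t‖ ^ 2 ≤ (1 + 4 / r * (m t - m s)) * ‖y s - z s‖ ^ 2
      + (m t - m s) * (16 * η ^ 2 / r + 12 * η) := by
  set M := m t - m s with hM
  have hM0 : 0 ≤ M := (norm_nonneg _).trans hy.norm_le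
  have h1 := hy.inner_le _ hzs
  have h2 := hz.inner_le _ hys
  rw [norm_sub_rev] at h1
  set d := ‖y s - z s‖ with hd
  have e : y t - z t = (y s - z s) + ((y t - y s) - (z t - z s)) := by abel
  have h3 : ‖y t - z t‖ ^ 2 = d ^ 2 + 2 * inner ℝ (y s - z s) ((y t - y s) - (z t - z s))
      + ‖(y t - y s) - (z t - z s)‖ ^ 2 := by
    rw [e, norm_add_sq_real]
  have h4 : inner ℝ (y s - z s) ((y t - y s) - (z t - z s)) =
      inner ℝ (y s - y t) (z s - y s) + inner ℝ (z s - z t) (y s - z s) := by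
    rw [inner_sub_right, ← real_inner_comm (y s - z s), ← real_inner_comm (y s - z s),
      ← neg_sub (y s) (y t), ← neg_sub (z s) (z t), ← neg_sub (y s) (z s)]
    simp only [inner_neg_left, inner_neg_right]
    ring
  have h5 : ‖(y t - y s) - (z t - z s)‖ ≤ 2 * M := by
    have := norm_sub_le (y t - y s) (z t - z s)
    have := hy.norm_le
    have := hz.norm_le
    linarith
  have h6 : ‖(y t - y s) - (z t - z s)‖ ^ 2 ≤ (2 * M) ^ 2 := by gcongr
  have h7 : bracket r d M ≤ d ^ 2 / r + 4 * η ^ 2 / r + 2 * η := by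
    have : (d + 2 * M) ^ 2 / (2 * r) ≤ d ^ 2 / r + 4 * η ^ 2 / r := by
      rw [← add_div, div_le_div_iff₀ (by positivity) hr]
      nlinarith [sq_nonneg (d - 2 * M), mul_self_le_mul_self hM0 hη]
    unfold bracket
    linarith
  have h8 : M * bracket r d M ≤ M * (d ^ 2 / r + 4 * η ^ 2 / r + 2 * η) := by gcongr
  have h9 : M * M ≤ M * η := by gcongr
  have h10 : M * (4 * η ^ 2 / r) = M * (16 * η ^ 2 / r) / 4 := by ring
  have h11 : M * (d ^ 2 / r) = (4 / r * M) * d ^ 2 / 4 := by ring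
  rw [h3, h4]
  nlinarith

/-- Discrete Gronwall: two trajectories satisfying the step inequalities along a grid with clock
increments at most `η` stay close. -/
lemma norm_sub_sq_le_of_stepIneq {r : ℝ} (hr : 0 < r) {C : ℝ → Set H} {m : ℝ → ℝ} {y z : ℝ → H}
    {τ : ℕ → ℝ} {N : ℕ} {η : ℝ} (hη0 : 0 ≤ η)
    (hy : ∀ k < N, StepIneq r C m y (τ k) (τ (k + 1)))
    (hz : ∀ k < N, StepIneq r C m z (τ k) (τ (k + 1)))
    (hyC : ∀ k < N, y (τ k) ∈ C (τ k)) (hzC : ∀ k < N, z (τ k) ∈ C (τ k))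
    (hη : ∀ k < N, m (τ (k + 1)) - m (τ k) ≤ η) (h0 : y (τ 0) = z (τ 0)) :
    ‖y (τ N) - z (τ N)‖ ^ 2 ≤ Real.exp (4 / r * (m (τ N) - m (τ 0))) *
      ((m (τ N) - m (τ 0)) * (16 * η ^ 2 / r + 12 * η)) := by
  have key : ∀ n ≤ N, 0 ≤ m (τ n) - m (τ 0) ∧ ‖y (τ n) - z (τ n)‖ ^ 2 ≤
      Real.exp (4 / r * (m (τ n) - m (τ 0))) *
      ((m (τ n) - m (τ 0)) * (16 * η ^ 2 / r + 12 * η)) := by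
    intro n
    induction n with
    | zero => simp [h0]
    | succ n ih =>
      intro hn
      obtain ⟨i0, i1⟩ := ih (by omega)
      have h1 := (hy n hn).compare hr (hz n hn) (hyC n hn) (hzC n hn) (hη n hn)
      have hM0 : 0 ≤ m (τ (n + 1)) - m (τ n) := (norm_nonneg _).trans (hy n hn).norm_le
      set M := m (τ (n + 1)) - m (τ n) with hM
      set A := m (τ n) - m (τ 0) with hA
      have hsum : m (τ (n + 1)) - m (τ 0) = A + M := by rw [hA, hM]; ring
      rw [hsum]
      refine ⟨add_nonneg i0 hM0, ?_⟩
      set δ := 16 * η ^ 2 / r + 12 * η with hδ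
      have hδ0 : 0 ≤ δ := by positivity
      have h2 : 1 + 4 / r * M ≤ Real.exp (4 / r * M) := by
        have := Real.add_one_le_exp (4 / r * M); linarith
      have h3 : 1 ≤ Real.exp (4 / r * (A + M)) := Real.one_le_exp (by positivity)
      calc ‖y (τ (n + 1)) - z (τ (n + 1))‖ ^ 2
          ≤ (1 + 4 / r * M) * ‖y (τ n) - z (τ n)‖ ^ 2 + M * δ := h1
        _ ≤ Real.exp (4 / r * M) * (Real.exp (4 / r * A) * (A * δ)) + M * δ := by gcongr
        _ = Real.exp (4 / r * (A + M)) * (A * δ) + 1 * (M * δ) := by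
            rw [show 4 / r * (A + M) = 4 / r * M + 4 / r * A by ring, Real.exp_add]; ring
        _ ≤ Real.exp (4 / r * (A + M)) * (A * δ) + Real.exp (4 / r * (A + M)) * (M * δ) := by
            gcongr
        _ = _ := by ring
  exact (key N le_rfl).2

/-- The bound of the discrete Gronwall lemma is small for fine grids. -/
lemma exists_gronwall_bound_lt (r : ℝ) (A : ℝ) {ε : ℝ} (hε : 0 < ε) : ∃ η, 0 < η ∧ η < ε ∧
    Real.exp (4 / r * A) * (A * (16 * η ^ 2 / r + 12 * η)) < ε := by
  have hc : Continuous fun η : ℝ => Real.exp (4 / r * A) * (A * (16 * η ^ 2 / r + 12 * η)) := by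
    fun_prop
  have h1 := (hc.tendsto 0).mono_left (nhdsWithin_le_nhds (s := Ioi 0))
  simp only [ne_eq, OfNat.ofNat_ne_zero, not_false_eq_true, zero_pow, mul_zero, zero_div,
    add_zero] at h1
  obtain ⟨η, h2, h3⟩ := ((h1.eventually (gt_mem_nhds hε)).and (Ioo_mem_nhdsGT hε)).exists
  exact ⟨η, h3.1, h3.2, h2⟩

end Compare

/-! ### The catching-up algorithm -/

section CatchUp

variable {H : Type*} [NormedAddCommGroup H]

open Classical in
/-- A nearest point of `K` to `y`, or `y` itself if there is none. -/
noncomputable def nearest (K : Set H) (y : H) : H :=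
  if h : (proj K y).Nonempty then h.some else y

lemma nearest_mem_proj {K : Set H} {y : H} (h : (proj K y).Nonempty) :
    nearest K y ∈ proj K y := by
  rw [nearest, dif_pos h]; exact h.some_mem

/-- The dyadic time `k / 2 ^ n`. -/
noncomputable def node (n k : ℕ) : ℝ := (k : ℝ) / 2 ^ n

lemma node_nonneg (n k : ℕ) : 0 ≤ node n k := by unfold node; positivity

lemma node_mono (n : ℕ) : Monotone (node n) := by
  intro a b h; unfold node; gcongr

lemma node_zero (n : ℕ) : node n 0 = 0 := by simp [node]

lemma node_succ_sub (n k : ℕ) : node n (k + 1) - node n k = 1 / 2 ^ n := by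
  unfold node; push_cast; ring

lemma node_mul_pow (n T : ℕ) : node n (T * 2 ^ n) = T := by
  unfold node; push_cast; field_simp

lemma node_refine {n n' : ℕ} (h : n ≤ n') (k : ℕ) : node n k = node n' (k * 2 ^ (n' - n)) := by
  obtain ⟨d, rfl⟩ := Nat.exists_eq_add_of_le h
  unfold node
  rw [Nat.add_sub_cancel_left, pow_add]
  push_cast
  field_simp

lemma node_floor_le (n : ℕ) {t : ℝ} (ht : 0 ≤ t) : node n ⌊t * 2 ^ n⌋₊ ≤ t := by
  unfold node
  rw [div_le_iff₀ (by positivity)]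
  exact Nat.floor_le (by positivity)

lemma lt_node_floor_succ (n : ℕ) (t : ℝ) : t < node n (⌊t * 2 ^ n⌋₊ + 1) := by
  unfold node
  rw [lt_div_iff₀ (by positivity)]
  exact_mod_cast Nat.lt_floor_add_one (t * 2 ^ n)

lemma sub_node_floor_le (n : ℕ) (t : ℝ) : t - node n ⌊t * 2 ^ n⌋₊ ≤ 1 / 2 ^ n := by
  have h1 := lt_node_floor_succ n t
  have h2 := node_succ_sub n ⌊t * 2 ^ n⌋₊
  linarith

lemma floor_node (n k : ℕ) : ⌊node n k * 2 ^ n⌋₊ = k := by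
  unfold node
  rw [div_mul_cancel₀ _ (by positivity), Nat.floor_natCast]

lemma floor_le_of_le {n T : ℕ} {t : ℝ} (h : t ≤ T) : ⌊t * 2 ^ n⌋₊ ≤ T * 2 ^ n := by
  refine Nat.floor_le_of_le ?_
  push_cast
  gcongr

/-- The catching-up sequence on the dyadic grid of step `2⁻ⁿ`: each point is projected on the
next set. -/
noncomputable def catchUp (C : ℝ → Set H) (p₀ : H) (n : ℕ) : ℕ → H
  | 0 => p₀
  | k + 1 => nearest (C (node n (k + 1))) (catchUp C p₀ n k)

/-- The piecewise constant trajectory through the catching-up sequence. -/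
noncomputable def approx (C : ℝ → Set H) (p₀ : H) (n : ℕ) (t : ℝ) : H :=
  catchUp C p₀ n ⌊t * 2 ^ n⌋₊

lemma approx_node (C : ℝ → Set H) (p₀ : H) (n k : ℕ) :
    approx C p₀ n (node n k) = catchUp C p₀ n k := by
  rw [approx, floor_node]

lemma approx_node_floor (C : ℝ → Set H) (p₀ : H) (n : ℕ) (t : ℝ) :
    approx C p₀ n (node n ⌊t * 2 ^ n⌋₊) = approx C p₀ n t := by
  rw [approx_node, approx]

variable [InnerProductSpace ℝ H]

/-- A moving `r`-prox-regular set whose excess is controlled by the increments of a continuous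
monotone function `m`. -/
structure HasClock (r : ℝ) (C : ℝ → Set H) (m : ℝ → ℝ) : Prop where
  proxRegular : ∀ t, 0 ≤ t → IsProxRegular r (C t)
  mono : Monotone m
  cont : Continuous m
  excess_le : ∀ s t, 0 ≤ s → s ≤ t → excess (C s) (C t) ≤ ENNReal.ofReal (m t - m s)

lemma HasClock.infDist_le {r : ℝ} {C : ℝ → Set H} {m : ℝ → ℝ} (h : HasClock r C m) {s t : ℝ}
    (hs : 0 ≤ s) (hst : s ≤ t) {x : H} (hx : x ∈ C s) : Metric.infDist x (C t) ≤ m t - m s :=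
  infDist_le_of_excess_le hx (sub_nonneg.2 (h.mono hst)) (h.excess_le s t hs hst)

variable {r : ℝ} {C : ℝ → Set H} {m : ℝ → ℝ} {p₀ : H}

/-- The grid of step `2⁻ⁿ` is fine enough on its first `N` steps for the projections to exist. -/
def IsFine (r : ℝ) (m : ℝ → ℝ) (n N : ℕ) : Prop :=
  ∀ k < N, m (node n (k + 1)) - m (node n k) < r

lemma HasClock.nearest_spec (h : HasClock r C m) (hr : 0 < r) {s t : ℝ} (hs : 0 ≤ s)
    (hst : s ≤ t) (hlt : m t - m s < r) {p : H} (hp : p ∈ C s) :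
    nearest (C t) p ∈ proj (C t) p ∧ ‖nearest (C t) p - p‖ ≤ m t - m s := by
  have hd := h.infDist_le hs hst hp
  obtain ⟨q, hq⟩ := (h.proxRegular t (hs.trans hst)).exists_proj_eq_singleton hr
    (hd.trans_lt hlt)
  have hmem := nearest_mem_proj (K := C t) (y := p) (hq ▸ singleton_nonempty q)
  exact ⟨hmem, hmem.2 ▸ hd⟩

lemma HasClock.catchUp_mem (h : HasClock r C m) (hr : 0 < r) (hp₀ : p₀ ∈ C 0) {n N : ℕ}
    (hf : IsFine r m n N) {k : ℕ} (hk : k ≤ N) : catchUp C p₀ n k ∈ C (node n k) := by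
  induction k with
  | zero => rw [node_zero]; exact hp₀
  | succ k ih =>
    exact (h.nearest_spec hr (node_nonneg n k) (node_mono n k.le_succ) (hf k hk)
      (ih (by omega))).1.1

lemma HasClock.catchUp_step (h : HasClock r C m) (hr : 0 < r) (hp₀ : p₀ ∈ C 0) {n N : ℕ}
    (hf : IsFine r m n N) {k : ℕ} (hk : k < N) :
    catchUp C p₀ n k - catchUp C p₀ n (k + 1) ∈
      normalCone (C (node n (k + 1))) (catchUp C p₀ n (k + 1)) ∧
    ‖catchUp C p₀ n (k + 1) - catchUp C p₀ n k‖ ≤ m (node n (k + 1)) - m (node n k) := by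
  have h1 := h.nearest_spec hr (node_nonneg n k) (node_mono n k.le_succ) (hf k hk)
    (h.catchUp_mem hr hp₀ hf hk.le)
  exact ⟨sub_mem_normalCone h1.1, h1.2⟩

lemma HasClock.norm_catchUp_sub_le (h : HasClock r C m) (hr : 0 < r) (hp₀ : p₀ ∈ C 0) {n N : ℕ}
    (hf : IsFine r m n N) {i j : ℕ} (hij : i ≤ j) (hj : j ≤ N) :
    ‖catchUp C p₀ n j - catchUp C p₀ n i‖ ≤ m (node n j) - m (node n i) := by
  induction j, hij using Nat.le_induction with
  | base => simp
  | succ j hij ih =>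
    have h1 := ih (by omega)
    have h2 := (h.catchUp_step hr hp₀ hf (k := j) (by omega)).2
    have h3 := norm_add_le (catchUp C p₀ n (j + 1) - catchUp C p₀ n j)
      (catchUp C p₀ n j - catchUp C p₀ n i)
    rw [sub_add_sub_cancel] at h3
    linarith

lemma HasClock.stepIneq_approx (h : HasClock r C m) (hr : 0 < r) (hp₀ : p₀ ∈ C 0) {n N : ℕ}
    (hf : IsFine r m n N) {i j : ℕ} (hij : i ≤ j) (hj : j ≤ N) :
    StepIneq r C m (approx C p₀ n) (node n i) (node n j) := by
  refine ⟨by simpa only [approx_node] using h.norm_catchUp_sub_le hr hp₀ hf hij hj, ?_⟩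
  intro x hx
  simp only [approx_node]
  set a := catchUp C p₀ n with ha
  set M := m (node n j) - m (node n i) with hM
  have hM0 : 0 ≤ M := sub_nonneg.2 (h.mono (node_mono n hij))
  have key : ∀ k, i ≤ k → k ≤ j → inner ℝ (a i - a k) (x - a i) ≤
      (m (node n k) - m (node n i)) * bracket r ‖x - a i‖ M := by
    intro k hik
    induction k, hik using Nat.le_induction with
    | base => simp
    | succ k hik ih =>
      intro hkj
      have h1 := ih (by omega)
      have h2 := h.catchUp_step hr hp₀ hf (k := k) (by omega)
      have hle : m (node n (k + 1)) ≤ m (node n j) := h.mono (node_mono n hkj)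
      have h3 := (h.proxRegular _ (node_nonneg n (k + 1))).inner_le_bracket hr h2.1
        (x := x) (q := a i) (M := M)
        ((h.infDist_le (node_nonneg n i) (node_mono n (by omega)) hx).trans (by linarith))
        ((h.norm_catchUp_sub_le hr hp₀ hf (by omega) (by omega)).trans (by linarith))
      have h4 : ‖a k - a (k + 1)‖ * bracket r ‖x - a i‖ M ≤
          (m (node n (k + 1)) - m (node n k)) * bracket r ‖x - a i‖ M := by
        have := bracket_nonneg (d := ‖x - a i‖) hr hM0
        rw [norm_sub_rev]
        gcongr
        exact h2.2
      rw [← sub_add_sub_cancel (a i) (a k) (a (k + 1)), inner_add_left]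
      linarith
  exact key j hij le_rfl

lemma HasClock.exists_mesh (h : HasClock r C m) (T : ℝ) {η : ℝ} (hη : 0 < η) :
    ∃ n₀ : ℕ, ∀ n ≥ n₀, ∀ s t, 0 ≤ s → s ≤ t → t ≤ T → t - s ≤ 1 / 2 ^ n → m t - m s < η := by
  have hu := (isCompact_Icc (a := (0 : ℝ)) (b := T)).uniformContinuousOn_of_continuous
    h.cont.continuousOn
  obtain ⟨δ, hδ, hd⟩ := Metric.uniformContinuousOn_iff.1 hu η hη
  obtain ⟨n₀, hn₀⟩ := exists_pow_lt_of_lt_one hδ (y := (1 / 2 : ℝ)) (by norm_num)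
  refine ⟨n₀, fun n hn s t hs hst ht hts => ?_⟩
  have h1 : (1 : ℝ) / 2 ^ n ≤ (1 / 2) ^ n₀ := by
    rw [← one_div_pow]
    exact pow_le_pow_of_le_one (by norm_num) (by norm_num) hn
  have h2 := hd t ⟨hs.trans hst, ht⟩ s ⟨hs, hst.trans ht⟩ (by
    rw [Real.dist_eq, abs_of_nonneg (sub_nonneg.2 hst)]; linarith)
  rw [Real.dist_eq] at h2
  exact (le_abs_self _).trans_lt h2

lemma node_le_of_le {n T k : ℕ} (hk : k ≤ T * 2 ^ n) : node n k ≤ T := by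
  rw [← node_mul_pow n T]; exact node_mono n hk

lemma isFine_of_mesh {T n : ℕ}
    (hm : ∀ s t : ℝ, 0 ≤ s → s ≤ t → t ≤ T → t - s ≤ 1 / 2 ^ n → m t - m s < r) :
    IsFine r m n (T * 2 ^ n) := fun k hk =>
  hm _ _ (node_nonneg n k) (node_mono n k.le_succ) (node_le_of_le hk) (node_succ_sub n k).le

/-- The catching-up trajectories form a uniform Cauchy sequence on bounded intervals. A coarse
and a fine trajectory are compared at the nodes of the coarse grid, where both lie in the moving
set. -/
lemma HasClock.approx_cauchy (h : HasClock r C m) (hr : 0 < r) (hp₀ : p₀ ∈ C 0) (T : ℕ) {ε : ℝ}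
    (hε : 0 < ε) : ∃ n₀, ∀ n ≥ n₀, ∀ n' ≥ n, ∀ t : ℝ, 0 ≤ t → t ≤ T →
      ‖approx C p₀ n t - approx C p₀ n' t‖ ≤ ε := by
  obtain ⟨η, hη0, hη1, hη2⟩ := exists_gronwall_bound_lt r (m T - m 0)
    (ε := min r (min (ε / 2) ((ε / 2) ^ 2))) (by positivity)
  obtain ⟨n₀, hn₀⟩ := h.exists_mesh T hη0
  have hηr : η < r := hη1.trans_le (min_le_left _ _)
  have hηε : η < ε / 2 := hη1.trans_le ((min_le_right _ _).trans (min_le_left _ _))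
  have hfine : ∀ n ≥ n₀, IsFine r m n (T * 2 ^ n) := fun n hn => isFine_of_mesh
    fun s t hs hst ht hts => (hn₀ n hn s t hs hst ht hts).trans hηr
  refine ⟨n₀, fun n hn n' hn' t ht htT => ?_⟩
  set N := ⌊t * 2 ^ n⌋₊ with hN
  have hNT : N ≤ T * 2 ^ n := floor_le_of_le htT
  have href : ∀ k ≤ N, k * 2 ^ (n' - n) ≤ T * 2 ^ n' := by
    intro k hk
    calc k * 2 ^ (n' - n) ≤ T * 2 ^ n * 2 ^ (n' - n) := by gcongr; omega
      _ = T * 2 ^ n' := by rw [mul_assoc, ← pow_add, Nat.add_sub_cancel' hn']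
  have hcmp := norm_sub_sq_le_of_stepIneq hr (C := C) (m := m) (y := approx C p₀ n)
    (z := approx C p₀ n') (τ := node n) (N := N) hη0.le
    (fun k hk => h.stepIneq_approx hr hp₀ (hfine n hn) k.le_succ (by omega))
    (fun k hk => by
      rw [node_refine hn' k, node_refine hn' (k + 1)]
      exact h.stepIneq_approx hr hp₀ (hfine n' (hn.le.trans hn')) (by gcongr; omega)
        (href _ (by omega)))
    (fun k hk => by
      rw [approx_node]; exact h.catchUp_mem hr hp₀ (hfine n hn) (by omega))
    (fun k hk => by
      rw [node_refine hn' k, approx_node]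
      exact h.catchUp_mem hr hp₀ (hfine n' (hn.le.trans hn')) (href _ (by omega)))
    (fun k hk => (hn₀ n hn _ _ (node_nonneg n k) (node_mono n k.le_succ)
      (node_le_of_le (by omega)) (node_succ_sub n k).le).le)
    (by rw [approx_node, node_zero]; simp [approx, catchUp])
  have hA : m (node n N) - m (node n 0) ≤ m T - m 0 := by
    rw [node_zero]
    have := h.mono (node_le_of_le hNT)
    linarith
  have hA0 : 0 ≤ m (node n N) - m (node n 0) := sub_nonneg.2 (h.mono (node_mono n N.zero_le))
  have hb : ‖approx C p₀ n (node n N) - approx C p₀ n' (node n N)‖ ^ 2 ≤ (ε / 2) ^ 2 := by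
    refine hcmp.trans (le_trans ?_ (hη2.le.trans ((min_le_right _ _).trans (min_le_right _ _))))
    gcongr
  have hb2 := le_of_sq_le_sq hb (by positivity)
  rw [hN, approx_node_floor, ← hN] at hb2
  -- between coarse nodes only the fine trajectory moves
  have hb3 : ‖approx C p₀ n' t - approx C p₀ n' (node n N)‖ ≤ η := by
    have hle : N * 2 ^ (n' - n) ≤ ⌊t * 2 ^ n'⌋₊ := by
      refine Nat.le_floor ?_
      have := node_floor_le n ht
      rw [← hN, node_refine hn', node, div_le_iff₀ (by positivity)] at this
      exact_mod_cast this
    rw [← approx_node_floor C p₀ n' t, node_refine hn' N]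
    refine (h.stepIneq_approx hr hp₀ (hfine n' (hn.le.trans hn')) hle
      (floor_le_of_le htT)).norm_le.trans ?_
    rw [← node_refine hn' N]
    have h1 := h.mono (node_floor_le n' ht)
    have h2 := hn₀ n hn _ t (node_nonneg n N) (node_floor_le n ht) htT (sub_node_floor_le n t)
    linarith
  calc _ = ‖(approx C p₀ n t - approx C p₀ n' (node n N))
        - (approx C p₀ n' t - approx C p₀ n' (node n N))‖ := by rw [sub_sub_sub_cancel_right]
    _ ≤ ε / 2 + ε / 2 := (norm_sub_le _ _).trans (by linarith)
    _ = ε := by ring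

/-- The limit of the catching-up algorithm. -/
lemma HasClock.exists_limit [CompleteSpace H] (h : HasClock r C m) (hr : 0 < r)
    (hp₀ : p₀ ∈ C 0) : ∃ y : ℝ → H,
      (∀ (T : ℕ) (ε : ℝ), 0 < ε → ∃ n₀, ∀ n ≥ n₀, ∀ t : ℝ, 0 ≤ t → t ≤ T →
        ‖approx C p₀ n t - y t‖ ≤ ε) ∧
      y 0 = p₀ ∧ (∀ t, 0 ≤ t → y t ∈ C t) ∧
      ∀ s t, 0 ≤ s → s ≤ t → ‖y t - y s‖ ≤ m t - m s := by
  have hlim : ∀ t, 0 ≤ t → ∃ q, Tendsto (fun n => approx C p₀ n t) atTop (𝓝 q) := by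
    intro t ht
    obtain ⟨T, hT⟩ := exists_nat_ge t
    refine cauchySeq_tendsto_of_complete (Metric.cauchySeq_iff'.2 fun ε hε => ?_)
    obtain ⟨n₀, hn₀⟩ := h.approx_cauchy hr hp₀ T (half_pos hε)
    refine ⟨n₀, fun n hn => ?_⟩
    rw [dist_eq_norm, norm_sub_rev]
    exact (hn₀ n₀ le_rfl n hn t ht hT).trans_lt (half_lt_self hε)
  choose! y hy using hlim
  have hunif : ∀ (T : ℕ) (ε : ℝ), 0 < ε → ∃ n₀, ∀ n ≥ n₀, ∀ t : ℝ, 0 ≤ t → t ≤ T →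
        ‖approx C p₀ n t - y t‖ ≤ ε := by
    intro T ε hε
    obtain ⟨n₀, hn₀⟩ := h.approx_cauchy hr hp₀ T hε
    refine ⟨n₀, fun n hn t ht htT => ?_⟩
    refine le_of_tendsto ((tendsto_const_nhds.sub (hy t ht)).norm) ?_
    filter_upwards [eventually_ge_atTop n] with n' hn' using hn₀ n hn n' hn' t ht htT
  have hnode : ∀ t, 0 ≤ t → Tendsto (fun n => m (node n ⌊t * 2 ^ n⌋₊)) atTop (𝓝 (m t)) := by
    intro t ht
    refine (h.cont.tendsto t).comp ?_
    have h0 : Tendsto (fun n : ℕ => (1 : ℝ) / 2 ^ n) atTop (𝓝 0) := by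
      have := tendsto_pow_atTop_nhds_zero_of_lt_one (r := (1 / 2 : ℝ)) (by norm_num) (by norm_num)
      simpa using this
    refine tendsto_of_tendsto_of_tendsto_of_le_of_le (by simpa using h0.const_sub t)
      tendsto_const_nhds (fun n => ?_) (fun n => node_floor_le n ht)
    have := sub_node_floor_le n t
    rw [← one_div]
    linarith
  have hfine : ∀ T : ℕ, ∀ᶠ n in atTop, IsFine r m n (T * 2 ^ n) := by
    intro T
    obtain ⟨n₀, hn₀⟩ := h.exists_mesh T hr
    filter_upwards [eventually_ge_atTop n₀] with n hn using isFine_of_mesh (hn₀ n hn)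
  refine ⟨y, hunif, ?_, fun t ht => ?_, fun s t hs hst => ?_⟩
  · refine tendsto_nhds_unique (hy 0 le_rfl) ?_
    simp [approx, catchUp]
  · have hC := h.proxRegular t ht
    rw [hC.isClosed.mem_iff_infDist_zero hC.nonempty]
    obtain ⟨T, hT⟩ := exists_nat_ge t
    have h1 : Tendsto (fun n => Metric.infDist (approx C p₀ n t) (C t)) atTop
        (𝓝 (Metric.infDist (y t) (C t))) :=
      (Metric.continuous_infDist_pt (C t)).continuousAt.tendsto.comp (hy t ht)
    have h2 : Tendsto (fun n => m t - m (node n ⌊t * 2 ^ n⌋₊)) atTop (𝓝 0) := by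
      simpa using (hnode t ht).const_sub (m t)
    refine le_antisymm (le_of_tendsto_of_tendsto h1 h2 ?_) Metric.infDist_nonneg
    filter_upwards [hfine T] with n hn
    exact h.infDist_le (node_nonneg _ _) (node_floor_le n ht)
      (h.catchUp_mem hr hp₀ hn (floor_le_of_le hT))
  · obtain ⟨T, hT⟩ := exists_nat_ge t
    have ht := hs.trans hst
    refine le_of_tendsto_of_tendsto ((hy t ht).sub (hy s hs)).norm
      ((hnode t ht).sub (hnode s hs)) ?_
    filter_upwards [hfine T] with n hn
    exact h.norm_catchUp_sub_le hr hp₀ hn (Nat.floor_mono (by gcongr)) (floor_le_of_le hT)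

end CatchUp

/-! ### The density of the limit trajectory -/

/-- A decreasing sequence of closed convex subsets of a Hilbert space that all meet a fixed ball
has a common point: the elements of minimal norm form a Cauchy sequence. -/
lemma nonempty_iInter_of_convex {E : Type*} [NormedAddCommGroup E] [InnerProductSpace ℝ E]
    [CompleteSpace E] {K : ℕ → Set E} (hanti : Antitone K) (hclosed : ∀ n, IsClosed (K n))
    (hconv : ∀ n, Convex ℝ (K n)) {R : ℝ} (hR : ∀ n, ∃ x ∈ K n, ‖x‖ ≤ R) :
    (⋂ n, K n).Nonempty := by
  have hmin : ∀ n, ∃ x ∈ K n, ∀ w ∈ K n, ‖x‖ ≤ ‖w‖ := by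
    intro n
    obtain ⟨z, hz, -⟩ := hR n
    obtain ⟨x, hx, hxe⟩ := exists_norm_eq_iInf_of_complete_convex ⟨z, hz⟩
      (hclosed n).isComplete (hconv n) 0
    refine ⟨x, hx, fun w hw => ?_⟩
    have h1 : (⨅ w : K n, ‖(0 : E) - w‖) ≤ ‖(0 : E) - w‖ :=
      ciInf_le (f := fun w : K n => ‖(0 : E) - w‖)
        ⟨0, by rintro _ ⟨w, rfl⟩; exact norm_nonneg _⟩ ⟨w, hw⟩
    rw [← hxe] at h1
    simpa using h1
  choose x hxK hxmin using hmin
  have hmono : Monotone fun n => ‖x n‖ ^ 2 := fun n k hnk => by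
    have := hxmin n (x k) (hanti hnk (hxK k))
    dsimp only
    gcongr
  have hbdd : BddAbove (range fun n => ‖x n‖ ^ 2) := by
    refine ⟨R ^ 2, ?_⟩
    rintro _ ⟨n, rfl⟩
    obtain ⟨z, hz, hzR⟩ := hR n
    have := (hxmin n z hz).trans hzR
    dsimp only
    gcongr
  have hlim := tendsto_atTop_ciSup hmono hbdd
  set S := ⨆ n, ‖x n‖ ^ 2 with hS
  have hle : ∀ n, ‖x n‖ ^ 2 ≤ S := fun n => le_ciSup hbdd n
  have hcauchy : CauchySeq x := by
    refine cauchySeq_of_le_tendsto_0' (fun n => √(2 * (S - ‖x n‖ ^ 2))) (fun n k hnk => ?_) ?_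
    · have hmid : ‖x n‖ ≤ ‖(1 / 2 : ℝ) • x n + (1 / 2 : ℝ) • x k‖ :=
        hxmin n _ (hconv n (hxK n) (hanti hnk (hxK k)) (by norm_num) (by norm_num)
          (by norm_num))
      rw [← smul_add, norm_smul, Real.norm_of_nonneg (by norm_num)] at hmid
      have hmid2 : (2 * ‖x n‖) ^ 2 ≤ ‖x n + x k‖ ^ 2 := by gcongr; linarith
      have hp := parallelogram_law_with_norm ℝ (x n) (x k)
      rw [dist_eq_norm]
      refine Real.le_sqrt_of_sq_le ?_
      have := hle k
      nlinarith
    · have := ((hlim.const_sub S).const_mul 2).sqrt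
      simpa using this
  obtain ⟨z, hz⟩ := cauchySeq_tendsto_of_complete hcauchy
  refine ⟨z, mem_iInter.2 fun n => (hclosed n).mem_of_tendsto hz ?_⟩
  filter_upwards [eventually_ge_atTop n] with k hk using hanti hk (hxK k)

section Density

variable {H : Type*} [NormedAddCommGroup H] [InnerProductSpace ℝ H]

/-- The velocities of norm at most one that are admissible at the point `p` of `K`, up to an
error `ε`; for `ε = 0` their opposites are proximal normals. -/
def admissible (r : ℝ) (K : Set H) (p : H) (ε : ℝ) : Set H :=
  {u | ‖u‖ ≤ 1 ∧ ∀ x ∈ K, inner ℝ (-u) (x - p) ≤ bracket r ‖x - p‖ ε}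

lemma isClosed_admissible (r : ℝ) (K : Set H) (p : H) (ε : ℝ) :
    IsClosed (admissible r K p ε) := by
  have : admissible r K p ε = {u | ‖u‖ ≤ 1} ∩
      ⋂ x ∈ K, {u | inner ℝ (-u) (x - p) ≤ bracket r ‖x - p‖ ε} := by
    ext u; simp [admissible]
  rw [this]
  refine (isClosed_le continuous_norm continuous_const).inter ?_
  exact isClosed_biInter fun x _ => isClosed_le (by fun_prop) continuous_const

lemma convex_admissible (r : ℝ) (K : Set H) (p : H) (ε : ℝ) :
    Convex ℝ (admissible r K p ε) := by
  intro u hu w hw a b ha hb hab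
  refine ⟨?_, fun x hx => ?_⟩
  · calc ‖a • u + b • w‖ ≤ a * ‖u‖ + b * ‖w‖ := by
          refine (norm_add_le _ _).trans ?_
          rw [norm_smul, norm_smul, Real.norm_of_nonneg ha, Real.norm_of_nonneg hb]
      _ ≤ a * 1 + b * 1 := by gcongr; exacts [hu.1, hw.1]
      _ = 1 := by linarith
  · have h1 := hu.2 x hx
    have h2 := hw.2 x hx
    rw [neg_add, ← smul_neg, ← smul_neg, inner_add_left, inner_smul_left, inner_smul_left]
    simp only [conj_trivial]
    calc _ ≤ a * bracket r ‖x - p‖ ε + b * bracket r ‖x - p‖ ε := by gcongr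
      _ = _ := by rw [← add_mul, hab, one_mul]

lemma admissible_mono {r : ℝ} (hr : 0 < r) (K : Set H) (p : H) {ε ε' : ℝ} (hε : 0 ≤ ε)
    (h : ε ≤ ε') : admissible r K p ε ⊆ admissible r K p ε' :=
  fun _ hu => ⟨hu.1, fun x hx => (hu.2 x hx).trans
    (bracket_mono hr (norm_nonneg _) le_rfl hε h)⟩

lemma neg_mem_normalCone_of_admissible {r : ℝ} (hr : 0 < r) {K : Set H} {p u : H} (hp : p ∈ K)
    {ε : ℕ → ℝ} (hε : Tendsto ε atTop (𝓝 0)) (hu : ∀ n, u ∈ admissible r K p (ε n)) :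
    -u ∈ normalCone K p := by
  refine mem_normalCone_of_inner_le hr hp fun x hx => ?_
  have h1 : Tendsto (fun n => bracket r ‖x - p‖ (ε n)) atTop (𝓝 (bracket r ‖x - p‖ 0)) := by
    have hc : Continuous fun e : ℝ => bracket r ‖x - p‖ e := by unfold bracket; fun_prop
    exact (hc.tendsto 0).comp hε
  have h2 := ge_of_tendsto' h1 fun n => (hu n).2 x hx
  simpa [bracket] using h2

/-- The measure `μ` has distribution function `m`. -/
def HasDistribution (μ : Measure ℝ) (m : ℝ → ℝ) : Prop :=
  ∀ s t, μ (Ioc s t) = ENNReal.ofReal (m t - m s)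

lemma HasDistribution.lt_top {μ : Measure ℝ} {m : ℝ → ℝ} (hμ : HasDistribution μ m) (s t : ℝ) :
    μ (Ioc s t) < ∞ := by
  rw [hμ]; exact ENNReal.ofReal_lt_top

lemma HasDistribution.real_Ioc {μ : Measure ℝ} {m : ℝ → ℝ} (hμ : HasDistribution μ m)
    (hm : Monotone m) {s t : ℝ} (hst : s ≤ t) : μ.real (Ioc s t) = m t - m s := by
  rw [measureReal_def, hμ, ENNReal.toReal_ofReal (sub_nonneg.2 (hm hst))]

variable {r : ℝ} {C : ℝ → Set H} {m : ℝ → ℝ} {p₀ : H}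

/-- The velocity, relative to the clock `m`, of the catching-up sequence on its `k`-th step. -/
noncomputable def stepVelocity (C : ℝ → Set H) (m : ℝ → ℝ) (p₀ : H) (n k : ℕ) : H :=
  (m (node n (k + 1)) - m (node n k))⁻¹ • (catchUp C p₀ n (k + 1) - catchUp C p₀ n k)

/-- The piecewise constant velocity of the catching-up sequence. -/
noncomputable def velocity (C : ℝ → Set H) (m : ℝ → ℝ) (p₀ : H) (n : ℕ) (t : ℝ) : H :=
  stepVelocity C m p₀ n (⌈t * 2 ^ n⌉₊ - 1)

lemma stronglyMeasurable_velocity (C : ℝ → Set H) (m : ℝ → ℝ) (p₀ : H) (n : ℕ) :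
    StronglyMeasurable (velocity C m p₀ n) := by
  have h1 : StronglyMeasurable fun k : ℕ => stepVelocity C m p₀ n (k - 1) :=
    StronglyMeasurable.of_discrete
  exact h1.comp_measurable (Nat.measurable_ceil.comp (measurable_id.mul_const _))

lemma velocity_eq {n k : ℕ} {t : ℝ} (ht : t ∈ Ioc (node n k) (node n (k + 1))) :
    velocity C m p₀ n t = stepVelocity C m p₀ n k := by
  have h2 : (0 : ℝ) < 2 ^ n := by positivity
  have h : ⌈t * 2 ^ n⌉₊ = k + 1 := by
    rw [Nat.ceil_eq_iff (by omega)]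
    have h1 := ht.1
    have h3 := ht.2
    rw [node, div_lt_iff₀ h2] at h1
    rw [node, le_div_iff₀ h2] at h3
    exact ⟨by simpa using h1, h3⟩
  rw [velocity, h, Nat.add_sub_cancel]

lemma exists_mem_step {n T : ℕ} {t : ℝ} (ht : t ∈ Ioc (0 : ℝ) T) :
    ∃ k < T * 2 ^ n, t ∈ Ioc (node n k) (node n (k + 1)) := by
  have h2 : (0 : ℝ) < 2 ^ n := by positivity
  have hpos : 0 < ⌈t * 2 ^ n⌉₊ := Nat.ceil_pos.2 (mul_pos ht.1 h2)
  have hle : ⌈t * 2 ^ n⌉₊ ≤ T * 2 ^ n := by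
    refine Nat.ceil_le.2 ?_
    push_cast
    exact mul_le_mul_of_nonneg_right ht.2 h2.le
  refine ⟨⌈t * 2 ^ n⌉₊ - 1, by omega, ?_, ?_⟩
  · rw [node, div_lt_iff₀ h2]
    exact Nat.lt_ceil.1 (by omega)
  · rw [node, le_div_iff₀ h2, Nat.sub_add_cancel hpos]
    exact Nat.le_ceil _

lemma HasClock.norm_stepVelocity_le (h : HasClock r C m) (hr : 0 < r) (hp₀ : p₀ ∈ C 0)
    {n N : ℕ} (hf : IsFine r m n N) {k : ℕ} (hk : k < N) :
    ‖stepVelocity C m p₀ n k‖ ≤ 1 := by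
  have h1 := (h.catchUp_step hr hp₀ hf hk).2
  have h0 : 0 ≤ m (node n (k + 1)) - m (node n k) := (norm_nonneg _).trans h1
  rw [stepVelocity, norm_smul, norm_inv, Real.norm_of_nonneg h0]
  exact inv_mul_le_one_of_le₀ h1 h0

lemma HasClock.norm_velocity_le (h : HasClock r C m) (hr : 0 < r) (hp₀ : p₀ ∈ C 0)
    {n T : ℕ} (hf : IsFine r m n (T * 2 ^ n)) {t : ℝ} (ht : t ∈ Ioc (0 : ℝ) T) :
    ‖velocity C m p₀ n t‖ ≤ 1 := by
  obtain ⟨k, hk, hkt⟩ := exists_mem_step (n := n) ht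
  rw [velocity_eq hkt]
  exact h.norm_stepVelocity_le hr hp₀ hf hk

/-- The catching-up velocity at time `t` is normal at a later time; since `C t` is close to the
later sets, it is admissible at time `t` up to a small error. -/
lemma HasClock.velocity_mem_admissible (h : HasClock r C m) (hr : 0 < r) (hp₀ : p₀ ∈ C 0)
    {n T : ℕ} (hf : IsFine r m n (T * 2 ^ n)) {y : ℝ → H} {η δ : ℝ} (hδ : 0 ≤ δ)
    (hη : ∀ s t : ℝ, 0 ≤ s → s ≤ t → t ≤ T → t - s ≤ 1 / 2 ^ n → m t - m s < η)
    (hy : ∀ s t, 0 ≤ s → s ≤ t → ‖y t - y s‖ ≤ m t - m s)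
    (hya : ∀ t : ℝ, 0 ≤ t → t ≤ T → ‖approx C p₀ n t - y t‖ ≤ δ) {t : ℝ}
    (ht : t ∈ Ioc (0 : ℝ) T) :
    velocity C m p₀ n t ∈ admissible r (C t) (y t) (η + δ) := by
  obtain ⟨k, hk, hkt⟩ := exists_mem_step (n := n) ht
  rw [velocity_eq hkt]
  have hnorm := h.norm_stepVelocity_le hr hp₀ hf hk
  refine ⟨hnorm, fun x hx => ?_⟩
  have hstep := h.catchUp_step hr hp₀ hf hk
  have hTk : node n (k + 1) ≤ T := node_le_of_le (by omega)
  have hinc : m (node n (k + 1)) - m t < η := by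
    refine hη _ _ ht.1.le hkt.2 hTk ?_
    have := node_succ_sub n k
    have := hkt.1
    linarith
  have hη0 : 0 ≤ η := (sub_nonneg.2 (h.mono hkt.2)).trans hinc.le
  have hu : -stepVelocity C m p₀ n k ∈
      normalCone (C (node n (k + 1))) (catchUp C p₀ n (k + 1)) := by
    rw [stepVelocity, ← smul_neg, neg_sub]
    exact smul_mem_normalCone (inv_nonneg.2 ((norm_nonneg _).trans hstep.2)) hstep.1
  have hp : ‖catchUp C p₀ n (k + 1) - y t‖ ≤ η + δ := by
    have h1 := hya (node n (k + 1)) (node_nonneg _ _) hTk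
    rw [approx_node] at h1
    have h2 := hy t (node n (k + 1)) ht.1.le hkt.2
    have h3 := norm_add_le (catchUp C p₀ n (k + 1) - y (node n (k + 1)))
      (y (node n (k + 1)) - y t)
    rw [sub_add_sub_cancel] at h3
    linarith
  have h4 := (h.proxRegular _ (node_nonneg n (k + 1))).inner_le_bracket hr hu (x := x)
    ((h.infDist_le ht.1.le hkt.2 hx).trans (by linarith)) hp
  refine h4.trans (mul_le_of_le_one_left (bracket_nonneg hr (by linarith)) ?_)
  rwa [norm_neg]

lemma HasClock.integrableOn_velocity (h : HasClock r C m) (hr : 0 < r) (hp₀ : p₀ ∈ C 0)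
    {n T : ℕ} (hf : IsFine r m n (T * 2 ^ n)) {μ : Measure ℝ} (hμ : HasDistribution μ m) :
    IntegrableOn (velocity C m p₀ n) (Ioc 0 T) μ :=
  Measure.integrableOn_of_bounded (hμ.lt_top _ _).ne
    (stronglyMeasurable_velocity C m p₀ n).aestronglyMeasurable
    (ae_restrict_of_forall_mem measurableSet_Ioc fun _ ht => h.norm_velocity_le hr hp₀ hf ht)

lemma setIntegral_Ioc_add {E : Type*} [NormedAddCommGroup E] [NormedSpace ℝ E] {f : ℝ → E}
    {μ : Measure ℝ} {a b c : ℝ} (hab : a ≤ b) (hbc : b ≤ c) (hf : IntegrableOn f (Ioc a c) μ) :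
    ∫ t in Ioc a c, f t ∂μ = ∫ t in Ioc a b, f t ∂μ + ∫ t in Ioc b c, f t ∂μ := by
  rw [← Ioc_union_Ioc_eq_Ioc hab hbc, setIntegral_union (Ioc_disjoint_Ioc_of_le le_rfl)
    measurableSet_Ioc (hf.mono_set (Ioc_subset_Ioc_right hbc))
    (hf.mono_set (Ioc_subset_Ioc_left hab))]

lemma HasClock.integral_velocity_node [CompleteSpace H] (h : HasClock r C m) (hr : 0 < r)
    (hp₀ : p₀ ∈ C 0) {n T : ℕ} (hf : IsFine r m n (T * 2 ^ n)) {μ : Measure ℝ}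
    (hμ : HasDistribution μ m) {k : ℕ} (hk : k ≤ T * 2 ^ n) :
    ∫ t in Ioc 0 (node n k), velocity C m p₀ n t ∂μ = catchUp C p₀ n k - p₀ := by
  induction k with
  | zero => simp [node_zero, catchUp]
  | succ k ih =>
    have hint := (h.integrableOn_velocity hr hp₀ hf hμ).mono_set
      (Ioc_subset_Ioc_right (node_le_of_le hk))
    rw [setIntegral_Ioc_add (node_nonneg n k) (node_mono n k.le_succ) hint, ih (by omega),
      setIntegral_congr_fun measurableSet_Ioc (fun t ht => velocity_eq ht), setIntegral_const,
      hμ.real_Ioc h.mono (node_mono n k.le_succ), stepVelocity, smul_smul]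
    have h1 := (h.catchUp_step hr hp₀ hf (k := k) (by omega)).2
    rcases eq_or_ne (m (node n (k + 1)) - m (node n k)) 0 with h0 | h0
    · rw [h0] at h1
      have h2 := sub_eq_zero.1 (norm_le_zero_iff.1 h1)
      rw [h2, sub_self, smul_zero, add_zero]
    · rw [mul_inv_cancel₀ h0, one_smul]
      abel

lemma HasClock.norm_integral_velocity_sub_le [CompleteSpace H] (h : HasClock r C m) (hr : 0 < r)
    (hp₀ : p₀ ∈ C 0) {n T : ℕ} (hf : IsFine r m n (T * 2 ^ n)) {μ : Measure ℝ}
    (hμ : HasDistribution μ m) {y : ℝ → H} (hy0 : y 0 = p₀) {η δ : ℝ}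
    (hη : ∀ s t : ℝ, 0 ≤ s → s ≤ t → t ≤ T → t - s ≤ 1 / 2 ^ n → m t - m s < η)
    (hya : ∀ t : ℝ, 0 ≤ t → t ≤ T → ‖approx C p₀ n t - y t‖ ≤ δ) {t : ℝ}
    (ht : t ∈ Icc (0 : ℝ) T) :
    ‖∫ s in Ioc 0 t, velocity C m p₀ n s ∂μ - (y t - y 0)‖ ≤ η + δ := by
  set k := ⌊t * 2 ^ n⌋₊ with hk
  have hkt : node n k ≤ t := node_floor_le n ht.1
  have hint := (h.integrableOn_velocity hr hp₀ hf hμ).mono_set (Ioc_subset_Ioc_right ht.2)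
  rw [setIntegral_Ioc_add (node_nonneg n k) hkt hint,
    h.integral_velocity_node hr hp₀ hf hμ (floor_le_of_le ht.2), hy0]
  have h1 : ‖∫ s in Ioc (node n k) t, velocity C m p₀ n s ∂μ‖ ≤ η := by
    refine (norm_setIntegral_le_of_norm_le_const (C := 1) (hμ.lt_top _ _)
      fun s hs => h.norm_velocity_le hr hp₀ hf
        ⟨(node_nonneg n k).trans_lt hs.1, hs.2.trans ht.2⟩).trans ?_
    rw [one_mul, hμ.real_Ioc h.mono hkt]
    exact (hη _ _ (node_nonneg n k) hkt ht.2 (sub_node_floor_le n t)).le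
  have h2 := hya t ht.1 ht.2
  have e : catchUp C p₀ n k - p₀ + ∫ s in Ioc (node n k) t, velocity C m p₀ n s ∂μ - (y t - p₀)
      = (∫ s in Ioc (node n k) t, velocity C m p₀ n s ∂μ) + (approx C p₀ n t - y t) := by
    rw [approx]; abel
  rw [e]
  exact (norm_add_le _ _).trans (by linarith)

/-- The `L²` functions that are densities of `y` up to an error `ε`. -/
def approxDensity (r : ℝ) (C : ℝ → Set H) (μ : Measure ℝ) (y : ℝ → H) (T ε : ℝ) :
    Set (Lp H 2 (μ.restrict (Ioc 0 T))) :=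
  {φ | (∀ᵐ t ∂μ.restrict (Ioc 0 T), φ t ∈ admissible r (C t) (y t) ε) ∧
    ∀ t ∈ Icc 0 T, ‖∫ s in Ioc 0 t, φ s ∂μ - (y t - y 0)‖ ≤ ε}

lemma isClosed_approxDensity (r : ℝ) (C : ℝ → Set H) {μ : Measure ℝ} (y : ℝ → H) (T ε : ℝ)
    (hfin : μ (Ioc 0 T) < ∞) : IsClosed (approxDensity r C μ y T ε) := by
  refine IsSeqClosed.isClosed fun φ ψ hφ hlim => ?_
  obtain ⟨ns, -, hns⟩ := (tendstoInMeasure_of_tendsto_Lp hlim).exists_seq_tendsto_ae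
  have hall : ∀ᵐ t ∂μ.restrict (Ioc 0 T), ∀ i, φ i t ∈ admissible r (C t) (y t) ε :=
    ae_all_iff.2 fun i => (hφ i).1
  refine ⟨?_, fun t ht => ?_⟩
  · filter_upwards [hns, hall] with t h1 h2
    exact (isClosed_admissible r (C t) (y t) ε).mem_of_tendsto h1
      (Eventually.of_forall fun i => h2 (ns i))
  · have hsub : Ioc 0 t ⊆ Ioc 0 T := Ioc_subset_Ioc_right ht.2
    have hle : μ.restrict (Ioc 0 t) ≤ μ.restrict (Ioc 0 T) := Measure.restrict_mono_set μ hsub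
    have hconv : Tendsto (fun i => ∫ s in Ioc 0 t, φ (ns i) s ∂μ) atTop
        (𝓝 (∫ s in Ioc 0 t, ψ s ∂μ)) := by
      refine tendsto_integral_of_dominated_convergence (fun _ => 1) (fun i => ?_) ?_
        (fun i => ?_) ?_
      · exact (Lp.aestronglyMeasurable (φ (ns i))).mono_measure hle
      · exact integrableOn_const ((measure_mono hsub).trans_lt hfin).ne
      · filter_upwards [ae_mono hle hall] with s hs using (hs (ns i)).1
      · exact ae_mono hle hns
    exact le_of_tendsto (hconv.sub_const _).norm
      (Eventually.of_forall fun i => (hφ (ns i)).2 t ht)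

lemma convex_approxDensity (r : ℝ) (C : ℝ → Set H) {μ : Measure ℝ} (y : ℝ → H) (T ε : ℝ)
    (hfin : μ (Ioc 0 T) < ∞) : Convex ℝ (approxDensity r C μ y T ε) := by
  have : IsFiniteMeasure (μ.restrict (Ioc 0 T)) := ⟨by simpa using hfin⟩
  intro φ hφ ψ hψ a b ha hb hab
  have hae : ∀ᵐ t ∂μ.restrict (Ioc 0 T), (a • φ + b • ψ : Lp H 2 (μ.restrict (Ioc 0 T))) t =
      a • φ t + b • ψ t := by
    filter_upwards [Lp.coeFn_add (a • φ) (b • ψ), Lp.coeFn_smul a φ, Lp.coeFn_smul b ψ]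
      with t h1 h2 h3
    rw [h1, Pi.add_apply, h2, h3, Pi.smul_apply, Pi.smul_apply]
  refine ⟨?_, fun t ht => ?_⟩
  · filter_upwards [hae, hφ.1, hψ.1] with t h1 h2 h3
    rw [h1]
    exact convex_admissible r (C t) (y t) ε h2 h3 ha hb hab
  · have hsub : Ioc 0 t ⊆ Ioc 0 T := Ioc_subset_Ioc_right ht.2
    have hle : μ.restrict (Ioc 0 t) ≤ μ.restrict (Ioc 0 T) := Measure.restrict_mono_set μ hsub
    have hi : ∀ f : Lp H 2 (μ.restrict (Ioc 0 T)), IntegrableOn f (Ioc 0 t) μ := fun f =>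
      ((Lp.memLp f).integrable one_le_two).mono_measure hle
    rw [integral_congr_ae (ae_mono hle hae),
      integral_add (f := fun s => a • φ s) (g := fun s => b • ψ s) ((hi φ).smul a) ((hi ψ).smul b),
      integral_smul, integral_smul]
    have e : a • ∫ s in Ioc 0 t, φ s ∂μ + b • ∫ s in Ioc 0 t, ψ s ∂μ - (y t - y 0) =
        a • (∫ s in Ioc 0 t, φ s ∂μ - (y t - y 0))
          + b • (∫ s in Ioc 0 t, ψ s ∂μ - (y t - y 0)) := by
      have : y t - y 0 = a • (y t - y 0) + b • (y t - y 0) := by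
        rw [← add_smul, hab, one_smul]
      conv_lhs => rw [this]
      simp only [smul_sub]
      abel
    rw [e]
    refine (norm_add_le _ _).trans ?_
    rw [norm_smul, norm_smul, Real.norm_of_nonneg ha, Real.norm_of_nonneg hb]
    have h1 := hφ.2 t ht
    have h2 := hψ.2 t ht
    calc _ ≤ a * ε + b * ε := by gcongr
      _ = ε := by rw [← add_mul, hab, one_mul]

/-- The limit trajectory has on each interval `(0, T]` a density of norm at most one whose opposite
is normal to the moving set: it is a common element of the closed convex sets of approximate
densities, which contain the catching-up velocities. -/
lemma HasClock.exists_density_Ioc [CompleteSpace H] (h : HasClock r C m) (hr : 0 < r)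
    (hp₀ : p₀ ∈ C 0) {μ : Measure ℝ} (hμ : HasDistribution μ m) {y : ℝ → H} (hy0 : y 0 = p₀)
    (hyC : ∀ t, 0 ≤ t → y t ∈ C t) (hy : ∀ s t, 0 ≤ s → s ≤ t → ‖y t - y s‖ ≤ m t - m s)
    (hlim : ∀ (T : ℕ) (ε : ℝ), 0 < ε → ∃ n₀, ∀ n ≥ n₀, ∀ t : ℝ, 0 ≤ t → t ≤ T →
      ‖approx C p₀ n t - y t‖ ≤ ε) (T : ℕ) :
    ∃ v : ℝ → H, AEStronglyMeasurable v (μ.restrict (Ioc 0 T)) ∧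
      (∀ᵐ t ∂μ.restrict (Ioc 0 T), ‖v t‖ ≤ 1 ∧ -v t ∈ normalCone (C t) (y t)) ∧
      ∀ t ∈ Icc (0 : ℝ) T, ∫ s in Ioc 0 t, v s ∂μ = y t - y 0 := by
  have hfin := hμ.lt_top 0 T
  have : IsFiniteMeasure (μ.restrict (Ioc 0 (T : ℝ))) := ⟨by simpa using hfin⟩
  let ε : ℕ → ℝ := fun j => 1 / ((j : ℝ) + 1)
  have hεpos : ∀ j, 0 < ε j := fun j => by positivity
  have hε : Tendsto ε atTop (𝓝 0) := tendsto_one_div_add_atTop_nhds_zero_nat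
  have hεanti : Antitone ε := fun i j hij => by simp only [ε]; gcongr
  set K : ℕ → Set (Lp H 2 (μ.restrict (Ioc 0 (T : ℝ)))) :=
    fun j => approxDensity r C μ y T (ε j) with hK
  have hR : ∀ j, ∃ φ ∈ K j, ‖φ‖ ≤ ((μ (Ioc 0 (T : ℝ))).toNNReal : ℝ) ^ (2⁻¹ : ℝ) := by
    intro j
    have hε2 : 0 < ε j / 2 := half_pos (hεpos j)
    obtain ⟨n₁, hn₁⟩ := h.exists_mesh T (lt_min hε2 hr)
    obtain ⟨n₂, hn₂⟩ := hlim T (ε j / 2) hε2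
    set n := max n₁ n₂
    have hmesh := hn₁ n (le_max_left _ _)
    have hη : ∀ s t : ℝ, 0 ≤ s → s ≤ t → t ≤ T → t - s ≤ 1 / 2 ^ n → m t - m s < ε j / 2 :=
      fun s t a b c d => (hmesh s t a b c d).trans_le (min_le_left _ _)
    have hf : IsFine r m n (T * 2 ^ n) := isFine_of_mesh
      fun s t a b c d => (hmesh s t a b c d).trans_le (min_le_right _ _)
    have hya := hn₂ n (le_max_right _ _)
    have hbd : ∀ᵐ t ∂μ.restrict (Ioc 0 (T : ℝ)), ‖velocity C m p₀ n t‖ ≤ 1 :=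
      ae_restrict_of_forall_mem measurableSet_Ioc fun t ht => h.norm_velocity_le hr hp₀ hf ht
    have hmem : MemLp (velocity C m p₀ n) 2 (μ.restrict (Ioc 0 (T : ℝ))) :=
      MemLp.of_bound (stronglyMeasurable_velocity C m p₀ n).aestronglyMeasurable 1 hbd
    refine ⟨hmem.toLp, ⟨?_, fun t ht => ?_⟩, ?_⟩
    · filter_upwards [hmem.coeFn_toLp, ae_restrict_mem measurableSet_Ioc] with t h1 h2
      rw [h1]
      have := h.velocity_mem_admissible hr hp₀ hf hε2.le hη hy hya h2
      rwa [add_halves] at this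
    · have hle : μ.restrict (Ioc 0 t) ≤ μ.restrict (Ioc 0 (T : ℝ)) :=
        Measure.restrict_mono_set μ (Ioc_subset_Ioc_right ht.2)
      rw [integral_congr_ae (ae_mono hle hmem.coeFn_toLp)]
      have := h.norm_integral_velocity_sub_le hr hp₀ hf hμ hy0 hη hya ht
      rwa [add_halves] at this
    · have := Lp.norm_le_of_ae_bound (f := hmem.toLp) zero_le_one (by
        filter_upwards [hmem.coeFn_toLp, hbd] with t h1 h2
        rwa [h1])
      simpa [measureUnivNNReal] using this
  obtain ⟨v, hv⟩ := nonempty_iInter_of_convex (K := K)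
    (fun i j hij φ hφ => ⟨by
      filter_upwards [hφ.1] with t ht using
        admissible_mono hr _ _ (hεpos j).le (hεanti hij) ht,
      fun t ht => (hφ.2 t ht).trans (hεanti hij)⟩)
    (fun j => isClosed_approxDensity r C y T (ε j) hfin)
    (fun j => convex_approxDensity r C y T (ε j) hfin) hR
  rw [mem_iInter] at hv
  refine ⟨v, Lp.aestronglyMeasurable v, ?_, fun t ht => ?_⟩
  · filter_upwards [ae_all_iff.2 fun j => (hv j).1, ae_restrict_mem measurableSet_Ioc] with t h1 h2
    exact ⟨(h1 0).1, neg_mem_normalCone_of_admissible hr (hyC t h2.1.le) hε h1⟩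
  · refine sub_eq_zero.1 (norm_le_zero_iff.1 ?_)
    exact ge_of_tendsto' hε fun j => (hv j).2 t ht

lemma iUnion_Ioc_natCast : ⋃ N : ℕ, Ioc (N : ℝ) (N + 1) = Ioi 0 := by
  ext t
  simp only [mem_iUnion, mem_Ioc, mem_Ioi]
  refine ⟨fun ⟨N, h1, _⟩ => (Nat.cast_nonneg N).trans_lt h1, fun ht => ?_⟩
  have hpos : 0 < ⌈t⌉₊ := Nat.ceil_pos.2 ht
  refine ⟨⌈t⌉₊ - 1, Nat.lt_ceil.1 (by omega), ?_⟩
  have : ((⌈t⌉₊ - 1 : ℕ) : ℝ) + 1 = ⌈t⌉₊ := by exact_mod_cast Nat.sub_add_cancel hpos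
  rw [this]
  exact Nat.le_ceil t

/-- The density on `(0, ∞)`, obtained by gluing the densities on bounded intervals. -/
lemma HasClock.exists_density [CompleteSpace H] (h : HasClock r C m) (hr : 0 < r)
    (hp₀ : p₀ ∈ C 0) {μ : Measure ℝ} (hμ : HasDistribution μ m) {y : ℝ → H} (hy0 : y 0 = p₀)
    (hyC : ∀ t, 0 ≤ t → y t ∈ C t) (hy : ∀ s t, 0 ≤ s → s ≤ t → ‖y t - y s‖ ≤ m t - m s)
    (hlim : ∀ (T : ℕ) (ε : ℝ), 0 < ε → ∃ n₀, ∀ n ≥ n₀, ∀ t : ℝ, 0 ≤ t → t ≤ T →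
      ‖approx C p₀ n t - y t‖ ≤ ε) :
    ∃ v : ℝ → H, (∀ T, IntegrableOn v (Ioc 0 T) μ) ∧
      (∀ᵐ t ∂μ.restrict (Ioi 0), -v t ∈ normalCone (C t) (y t)) ∧
      ∀ s t, 0 ≤ s → s ≤ t → ∫ τ in Ioc s t, v τ ∂μ = y t - y s := by
  choose V hVm hVae hVint using h.exists_density_Ioc hr hp₀ hμ hy0 hyC hy hlim
  have hceil : ∀ (N : ℕ), ∀ t ∈ Ioc (N : ℝ) (N + 1), ⌈t⌉₊ = N + 1 := by
    intro N t ht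
    rw [Nat.ceil_eq_iff (by omega)]
    exact ⟨by simpa using ht.1, by push_cast; exact ht.2⟩
  let v : ℝ → H := fun t => V ⌈t⌉₊ t
  have hv : ∀ (N : ℕ), ∀ t ∈ Ioc (N : ℝ) (N + 1), v t = V (N + 1) t := by
    intro N t ht
    simp only [v, hceil N t ht]
  have hsub : ∀ N : ℕ, Ioc (N : ℝ) (N + 1) ⊆ Ioc 0 ((N + 1 : ℕ) : ℝ) := by
    intro N t ht
    exact ⟨(Nat.cast_nonneg N).trans_lt ht.1, by push_cast; exact ht.2⟩
  have hae : ∀ᵐ t ∂μ.restrict (Ioi 0), ‖v t‖ ≤ 1 ∧ -v t ∈ normalCone (C t) (y t) := by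
    rw [← iUnion_Ioc_natCast, ae_restrict_iUnion_iff]
    intro N
    filter_upwards [ae_mono (Measure.restrict_mono_set μ (hsub N)) (hVae (N + 1)),
      ae_restrict_mem measurableSet_Ioc] with t h1 h2
    rwa [hv N t h2]
  have hvm : AEStronglyMeasurable v (μ.restrict (Ioi 0)) := by
    rw [← iUnion_Ioc_natCast, aestronglyMeasurable_iUnion_iff]
    intro N
    refine ((hVm (N + 1)).mono_measure (Measure.restrict_mono_set μ (hsub N))).congr ?_
    exact ae_restrict_of_forall_mem measurableSet_Ioc fun t ht => (hv N t ht).symm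
  have hvi : ∀ T, IntegrableOn v (Ioc 0 T) μ := by
    intro T
    have hle : μ.restrict (Ioc 0 T) ≤ μ.restrict (Ioi 0) :=
      Measure.restrict_mono_set μ Ioc_subset_Ioi_self
    have : IsFiniteMeasure (μ.restrict (Ioc 0 T)) := ⟨by simpa using hμ.lt_top 0 T⟩
    exact Integrable.of_bound (hvm.mono_measure hle) 1
      (Eventually.mono (ae_mono hle hae) fun _ ht => ht.1)
  have hprim : ∀ (N : ℕ) (t : ℝ), 0 ≤ t → t ≤ N → ∫ τ in Ioc 0 t, v τ ∂μ = y t - y 0 := by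
    intro N
    induction N with
    | zero =>
      intro t h0 h1
      have : t = 0 := le_antisymm (by simpa using h1) h0
      simp [this]
    | succ N ih =>
      intro t h0 h1
      rcases le_or_gt t N with htN | htN
      · exact ih t h0 htN
      · have hN0 : (0 : ℝ) ≤ N := Nat.cast_nonneg N
        have hVi : IntegrableOn (V (N + 1)) (Ioc 0 t) μ := by
          have : IsFiniteMeasure (μ.restrict (Ioc 0 t)) := ⟨by simpa using hμ.lt_top 0 t⟩
          have hle : μ.restrict (Ioc 0 t) ≤ μ.restrict (Ioc 0 ((N + 1 : ℕ) : ℝ)) :=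
            Measure.restrict_mono_set μ (Ioc_subset_Ioc_right h1)
          exact Integrable.of_bound ((hVm (N + 1)).mono_measure hle) 1
            (Eventually.mono (ae_mono hle (hVae (N + 1))) fun _ ht => ht.1)
        have e1 := hVint (N + 1) t ⟨h0, h1⟩
        have e2 := hVint (N + 1) N ⟨hN0, by push_cast; linarith⟩
        rw [setIntegral_Ioc_add hN0 htN.le hVi, e2] at e1
        have e3 : ∫ τ in Ioc (N : ℝ) t, v τ ∂μ = ∫ τ in Ioc (N : ℝ) t, V (N + 1) τ ∂μ :=
          setIntegral_congr_fun measurableSet_Ioc fun τ hτ =>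
            hv N τ ⟨hτ.1, hτ.2.trans (by push_cast at h1; exact h1)⟩
        rw [setIntegral_Ioc_add hN0 htN.le (hvi t), ih N hN0 le_rfl, e3, ← e1]
  refine ⟨v, hvi, hae.mono fun _ ht => ht.2, fun s t hs hst => ?_⟩
  obtain ⟨N, hN⟩ := exists_nat_ge t
  have e1 := hprim N t (hs.trans hst) hN
  rw [setIntegral_Ioc_add hs hst (hvi t), hprim N s hs (hst.trans hN)] at e1
  rw [← sub_sub_sub_cancel_right (y t) (y s) (y 0), ← e1, add_sub_cancel_left]

end Density

/-! ### Existence of solutions -/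

section Existence

variable {H : Type*} [NormedAddCommGroup H]

lemma HasDistribution.nullSingletonClass {μ : Measure ℝ} {m : ℝ → ℝ} (hμ : HasDistribution μ m)
    (hm : Continuous m) : NullSingletonClass μ := by
  refine ⟨fun t => ?_⟩
  have h1 : Tendsto (fun s => ENNReal.ofReal (m t - m s)) (𝓝[<] t) (𝓝 0) := by
    have h := ((hm.tendsto t).const_sub (m t)).mono_left (nhdsWithin_le_nhds (s := Iio t))
    rw [sub_self] at h
    simpa using ENNReal.tendsto_ofReal h
  refine le_antisymm (ge_of_tendsto h1 ?_) zero_le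
  filter_upwards [self_mem_nhdsWithin] with s hs
  rw [← hμ]
  exact measure_mono (singleton_subset_iff.2 ⟨hs, le_rfl⟩)

lemma continuousOn_of_norm_sub_le {y : ℝ → H} {m : ℝ → ℝ} (hm : Continuous m)
    (hy : ∀ s t, 0 ≤ s → s ≤ t → ‖y t - y s‖ ≤ m t - m s) : ContinuousOn y (Ici 0) := by
  intro t ht
  rw [ContinuousWithinAt, tendsto_iff_norm_sub_tendsto_zero]
  have h1 : Tendsto (fun s => |m s - m t|) (𝓝[Ici 0] t) (𝓝 0) := by
    have h := (((hm.tendsto t).sub_const (m t)).abs).mono_left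
      (nhdsWithin_le_nhds (s := Ici 0))
    simpa using h
  refine squeeze_zero' (Eventually.of_forall fun _ => norm_nonneg _) ?_ h1
  filter_upwards [self_mem_nhdsWithin] with s hs
  rcases le_total s t with hst | hst
  · rw [norm_sub_rev, abs_sub_comm]
    exact (hy s t hs hst).trans (le_abs_self _)
  · exact (hy t s ht hst).trans (le_abs_self _)

lemma eVariationOn_le_of_norm_sub_le {y : ℝ → H} {m : ℝ → ℝ} (hm : Monotone m)
    (hy : ∀ s t, 0 ≤ s → s ≤ t → ‖y t - y s‖ ≤ m t - m s) {a b : ℝ} (ha : 0 ≤ a) (hab : a ≤ b) :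
    eVariationOn y (Icc a b) ≤ ENNReal.ofReal (m b - m a) := by
  have h1 : eVariationOn y (Icc a b) ≤ eVariationOn m (Icc a b) := by
    refine iSup_mono fun p => Finset.sum_le_sum fun i _ => ?_
    have h2 := p.2.2.1 i.le_succ
    have h3 := hy _ _ (ha.trans (p.2.2.2 i).1) h2
    rw [edist_dist, edist_dist, dist_eq_norm, Real.dist_eq]
    exact ENNReal.ofReal_le_ofReal (h3.trans (le_abs_self _))
  refine h1.trans ?_
  have h2 := (hm.monotoneOn (Icc a b)).eVariationOn_eq (left_mem_Icc.2 hab) (right_mem_Icc.2 hab)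
  rw [inter_self] at h2
  exact h2.le

lemma locallyBoundedVariationOn_of_norm_sub_le {y : ℝ → H} {m : ℝ → ℝ} (hm : Monotone m)
    (hy : ∀ s t, 0 ≤ s → s ≤ t → ‖y t - y s‖ ≤ m t - m s) :
    LocallyBoundedVariationOn y (Ici 0) := by
  intro a b ha hb
  rcases le_or_gt a b with hab | hab
  · exact (((eVariationOn.mono y inter_subset_right).trans
      (eVariationOn_le_of_norm_sub_le hm hy ha hab)).trans_lt ENNReal.ofReal_lt_top).ne
  · rw [Icc_eq_empty (not_le.2 hab), inter_empty]
    exact BoundedVariationOn.of_subsingleton subsingleton_empty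

lemma continuous_extendHalfLine {y : ℝ → H} (hy : ContinuousOn y (Ici 0)) :
    Continuous (extendHalfLine y) :=
  hy.comp_continuous (by fun_prop) fun t => le_max_left 0 t

lemma leftLim_extendHalfLine (z : ℝ → H) {t : ℝ} (ht : 0 < t) {l : H}
    (hl : Tendsto z (𝓝[<] t) (𝓝 l)) : Function.leftLim (extendHalfLine z) t = l := by
  refine leftLim_eq_of_tendsto (hl.congr' ?_)
  filter_upwards [Ioo_mem_nhdsLT ht] with s hs
  rw [extendHalfLine, max_eq_right hs.1.le]

lemma rightLim_extendHalfLine (z : ℝ → H) {t : ℝ} (ht : 0 ≤ t)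
    (hz : ContinuousWithinAt z (Ici t) t) : Function.rightLim (extendHalfLine z) t = z t := by
  refine rightLim_eq_of_tendsto ((hz.mono Ioi_subset_Ici_self).tendsto.congr' ?_)
  filter_upwards [self_mem_nhdsWithin] with s hs
  rw [extendHalfLine, max_eq_right (ht.trans (le_of_lt hs))]

lemma isDifferentialMeasure_of_continuous [InnerProductSpace ℝ H] {f v : ℝ → H} {μ : Measure ℝ}
    [NullSingletonClass μ] (hf : Continuous f)
    (hv : ∀ c d, c < d → ∫ t in Ioc c d, v t ∂μ = f d - f c) :
    IsDifferentialMeasure f v μ := by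
  have hl : ∀ t, Function.leftLim f t = f t := fun t => hf.continuousWithinAt.leftLim_eq
  have hr : ∀ t, Function.rightLim f t = f t := fun t => hf.continuousWithinAt.rightLim_eq
  intro c d hcd
  simp only [hl, hr, integral_Icc_eq_integral_Ioc, integral_Ico_eq_integral_Ioo,
    ← integral_Ioc_eq_integral_Ioo, hv c d hcd, and_self]

variable [InnerProductSpace ℝ H] {r : ℝ} {C : ℝ → Set H} {m : ℝ → ℝ}

lemma isDifferentialMeasure_extendHalfLine {y v : ℝ → H} {μ : Measure ℝ}
    [NullSingletonClass μ] (hy : ContinuousOn y (Ici 0))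
    (hv : ∀ s t, 0 ≤ s → s ≤ t → ∫ τ in Ioc s t, v τ ∂μ = y t - y s) :
    IsDifferentialMeasure (extendHalfLine y) v (μ.restrict (Ici 0)) := by
  refine isDifferentialMeasure_of_continuous (continuous_extendHalfLine hy) fun c d hcd => ?_
  have hset : Ioc c d ∩ Ioi 0 = Ioc (max 0 c) (max 0 d) := by
    rcases le_total d 0 with hd | hd
    · rw [max_eq_left hd, max_eq_left (hcd.le.trans hd), Ioc_self]
      ext t; simp only [mem_inter_iff, mem_Ioc, mem_Ioi, mem_empty_iff_false, iff_false]
      intro h; linarith [h.1.2, h.2]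
    · rw [max_eq_right hd]
      ext t; simp only [mem_inter_iff, mem_Ioc, mem_Ioi, max_lt_iff]; tauto
  rw [← Measure.restrict_congr_set Ioi_ae_eq_Ici, Measure.restrict_restrict measurableSet_Ioc,
    hset, hv _ _ (le_max_left _ _) (max_le_max le_rfl hcd.le)]
  rfl

/-- A moving prox-regular set with a continuous clock `m` admits a solution of the sweeping
process, whose differential measure has a density with respect to the measure with distribution
function `m`. -/
theorem HasClock.exists_solution [CompleteSpace H] (h : HasClock r C m) (hr : 0 < r)
    {μ : Measure ℝ} (hμ : HasDistribution μ m) {y₀ : H} (hy₀ : Metric.infDist y₀ (C 0) < r) :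
    ∃ y v : ℝ → H, IsSweepingSolution C y₀ y ∧
      (∀ s t, 0 ≤ s → s ≤ t → ‖y t - y s‖ ≤ m t - m s) ∧
      (∀ T, IntegrableOn v (Ioc 0 T) μ) ∧
      (∀ᵐ t ∂μ.restrict (Ioi 0), -v t ∈ normalCone (C t) (y t)) ∧
      ∀ s t, 0 ≤ s → s ≤ t → ∫ τ in Ioc s t, v τ ∂μ = y t - y s := by
  obtain ⟨p₀, hp₀⟩ := (h.proxRegular 0 le_rfl).exists_proj_eq_singleton hr hy₀
  have hp₀C : p₀ ∈ C 0 := (hp₀ ▸ mem_singleton p₀ : p₀ ∈ proj (C 0) y₀).1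
  obtain ⟨y, hlim, hy0, hyC, hy⟩ := h.exists_limit hr hp₀C
  obtain ⟨v, hvi, hvN, hv⟩ := h.exists_density hr hp₀C hμ hy0 hyC hy hlim
  have := hμ.nullSingletonClass h.cont
  have hcont := continuousOn_of_norm_sub_le h.cont hy
  refine ⟨y, v, ?_, hy, hvi, hvN, hv⟩
  refine ⟨locallyBoundedVariationOn_of_norm_sub_le h.mono hy,
    fun t ht => (hcont t ht).mono (Ici_subset_Ici.2 ht), hyC, ⟨μ, v, ?_, ?_, ?_⟩, ?_⟩
  · intro t _
    refine ⟨Icc 0 (t + 1), ?_, (integrableOn_Icc_iff_integrableOn_Ioc (by simp)).2 (hvi (t + 1))⟩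
    rw [← Ici_inter_Iic]
    exact inter_mem self_mem_nhdsWithin (nhdsWithin_le_nhds (Iic_mem_nhds (by linarith)))
  · exact isDifferentialMeasure_extendHalfLine hcont hv
  · rwa [← Measure.restrict_congr_set Ioi_ae_eq_Ici]
  · rw [hp₀, hy0]

end Existence

/-! ### Uniqueness of solutions -/

section Uniqueness

variable {H : Type*} [NormedAddCommGroup H] [InnerProductSpace ℝ H] {r : ℝ} {C : ℝ → Set H}
  {m : ℝ → ℝ}

/-- Comparing on finer and finer grids: trajectories satisfying all step inequalities for a
continuous clock are determined by their initial value. -/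
lemma HasClock.eqOn_of_stepIneq (h : HasClock r C m) (hr : 0 < r) {y z : ℝ → H}
    (hy : ∀ s t, 0 ≤ s → s ≤ t → StepIneq r C m y s t)
    (hz : ∀ s t, 0 ≤ s → s ≤ t → StepIneq r C m z s t)
    (hyC : ∀ t, 0 ≤ t → y t ∈ C t) (hzC : ∀ t, 0 ≤ t → z t ∈ C t) (h0 : y 0 = z 0) :
    EqOn y z (Ici 0) := by
  intro t ht
  have ht : 0 ≤ t := ht
  have key : ∀ ε > 0, ‖y t - z t‖ ^ 2 ≤ ε := by
    intro ε hε
    obtain ⟨η, hη0, -, hη2⟩ := exists_gronwall_bound_lt r (m t - m 0) hε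
    obtain ⟨n, hn⟩ := h.exists_mesh t hη0
    have hn := hn n le_rfl
    let τ : ℕ → ℝ := fun k => min (node n k) t
    have hτ0 : τ 0 = 0 := by simp [τ, node_zero, ht]
    have hτN : τ (⌊t * 2 ^ n⌋₊ + 1) = t := min_eq_right (lt_node_floor_succ n t).le
    have hτnn : ∀ k, 0 ≤ τ k := fun k => le_min (node_nonneg n k) ht
    have hτm : ∀ k, τ k ≤ τ (k + 1) := fun k => min_le_min_right _ (node_mono n k.le_succ)
    have hcmp := norm_sub_sq_le_of_stepIneq hr (C := C) (m := m) (y := y) (z := z) (τ := τ)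
      (N := ⌊t * 2 ^ n⌋₊ + 1) hη0.le (fun k _ => hy _ _ (hτnn k) (hτm k))
      (fun k _ => hz _ _ (hτnn k) (hτm k)) (fun k _ => hyC _ (hτnn k)) (fun k _ => hzC _ (hτnn k))
      (fun k _ => (hn _ _ (hτnn k) (hτm k) (min_le_right _ _) (by
        have h1 := node_succ_sub n k
        have h2 : (0 : ℝ) < 1 / 2 ^ n := by positivity
        simp only [τ]
        rcases le_total (node n k) t with h3 | h3
        · rw [min_eq_left h3]
          have := min_le_left (node n (k + 1)) t
          linarith
        · rw [min_eq_right h3]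
          have := min_le_right (node n (k + 1)) t
          linarith)).le)
      (by rw [hτ0]; exact h0)
    rw [hτ0, hτN] at hcmp
    exact hcmp.trans hη2.le
  have h1 : ‖y t - z t‖ ^ 2 ≤ 0 := le_of_forall_pos_le_add fun ε hε => by
    rw [zero_add]; exact key ε hε
  have h2 : ‖y t - z t‖ = 0 := pow_eq_zero_iff two_ne_zero |>.1 (le_antisymm h1 (sq_nonneg _))
  exact sub_eq_zero.1 (norm_eq_zero.1 h2)

/-- Integrating the inclusion over `(s, t]` yields the step inequality. -/
lemma HasClock.stepIneq_of_density [CompleteSpace H] (h : HasClock r C m) (hr : 0 < r)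
    {z v : ℝ → H} {ν : Measure ℝ} {s t : ℝ} (hs : 0 ≤ s) (hst : s ≤ t)
    (hvi : IntegrableOn v (Ioc s t) ν)
    (hN : ∀ᵐ τ ∂ν.restrict (Ioc s t), -v τ ∈ normalCone (C τ) (z τ))
    (hv : ∀ τ ∈ Icc s t, ∫ τ' in Ioc s τ, v τ' ∂ν = z τ - z s)
    (hm : ∫ τ in Ioc s t, ‖v τ‖ ∂ν ≤ m t - m s) : StepIneq r C m z s t := by
  have hM0 : 0 ≤ m t - m s := sub_nonneg.2 (h.mono hst)
  have hdisp : ∀ τ ∈ Icc s t, ‖z τ - z s‖ ≤ m t - m s := by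
    intro τ hτ
    rw [← hv τ hτ]
    refine (norm_integral_le_integral_norm _).trans (le_trans ?_ hm)
    exact setIntegral_mono_set hvi.norm (Eventually.of_forall fun _ => norm_nonneg _)
      (Ioc_subset_Ioc_right hτ.2).eventuallyLE
  refine ⟨hdisp t (right_mem_Icc.2 hst), fun x hx => ?_⟩
  have hpt : ∀ᵐ τ ∂ν.restrict (Ioc s t), inner ℝ (x - z s) (-v τ) ≤
      ‖v τ‖ * bracket r ‖x - z s‖ (m t - m s) := by
    filter_upwards [hN, ae_restrict_mem measurableSet_Ioc] with τ h1 h2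
    have h3 := (h.proxRegular τ (hs.trans h2.1.le)).inner_le_bracket hr h1 (x := x) (q := z s)
      ((h.infDist_le hs h2.1.le hx).trans (sub_le_sub_right (h.mono h2.2) _))
      (hdisp τ ⟨h2.1.le, h2.2⟩)
    rwa [norm_neg, real_inner_comm] at h3
  have e : inner ℝ (z s - z t) (x - z s) = ∫ τ in Ioc s t, inner ℝ (x - z s) (-v τ) ∂ν := by
    have hneg : ∫ τ in Ioc s t, -v τ ∂ν = z s - z t := by
      rw [integral_neg, hv t (right_mem_Icc.2 hst), neg_sub]
    rw [integral_inner (f := fun τ => -v τ) hvi.neg, hneg, real_inner_comm]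
  rw [e]
  calc _ ≤ ∫ τ in Ioc s t, ‖v τ‖ * bracket r ‖x - z s‖ (m t - m s) ∂ν :=
        integral_mono_ae (hvi.neg.const_inner _) (hvi.norm.mul_const _) hpt
    _ = (∫ τ in Ioc s t, ‖v τ‖ ∂ν) * bracket r ‖x - z s‖ (m t - m s) := integral_mul_const _ _
    _ ≤ _ := mul_le_mul_of_nonneg_right hm (bracket_nonneg hr hM0)

/-- For a moving set that is continuous from the left, a solution with jumps smaller than `r` has
no jumps: a jump would be normal to `C t` with both end points in `C t`. The atoms of its
differential measure therefore vanish. -/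
lemma IsSweepingSolution.tendsto_left [CompleteSpace H] (hr : 0 < r) (hC : IsContBRLoc r C)
    {y₀ : H} {z : ℝ → H} (hz : IsSweepingSolution C y₀ z) (hj : JumpsLT r z) {ν : Measure ℝ}
    {v : ℝ → H} (hvi : ∀ T, IntegrableOn v (Icc 0 T) ν)
    (hd : IsDifferentialMeasure (extendHalfLine z) v ν)
    (hN : ∀ᵐ t ∂ν, -v t ∈ normalCone (C t) (z t)) {t : ℝ} (ht : 0 < t) :
    Tendsto z (𝓝[<] t) (𝓝 (z t)) ∧ ν.real {t} • v t = 0 := by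
  obtain ⟨l, hl⟩ : ∃ l, Tendsto z (𝓝[<] t) (𝓝 l) := by
    have hbv : BoundedVariationOn z (Ici 0 ∩ Icc 0 t) := hz.locallyBV 0 t self_mem_Ici ht.le
    obtain ⟨l, hl⟩ := hbv.exists_tendsto_left t
    refine ⟨l, hl.mono_left ?_⟩
    rw [nhdsWithin_le_iff]
    filter_upwards [Ioo_mem_nhdsLT ht] with s hs
    exact ⟨⟨hs.1.le, hs.1.le, hs.2.le⟩, hs.2⟩
  have hlim : Function.leftLim z t = l := leftLim_eq_of_tendsto hl
  have hatom : ν.real {t} • v t = z t - l := by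
    obtain ⟨-, h1, h2, -⟩ := hd 0 t ht
    have hunion : Icc 0 t = Ico 0 t ∪ {t} := (Ico_union_right ht.le).symm
    rw [hunion, setIntegral_union (by simp) (measurableSet_singleton t)
      ((hvi t).mono_set Ico_subset_Icc_self)
      ((hvi t).mono_set (singleton_subset_iff.2 ⟨ht.le, le_rfl⟩)), h2, integral_singleton,
      leftLim_extendHalfLine z ht hl,
      rightLim_extendHalfLine z ht.le (hz.rightContinuous t ht.le)] at h1
    calc _ = (l - Function.leftLim (extendHalfLine z) 0 + ν.real {t} • v t)
          - (l - Function.leftLim (extendHalfLine z) 0) := by abel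
      _ = _ := by rw [h1]; abel
  have hP := hC.proxRegular t ht.le
  have hlC : l ∈ C t := by
    have h1 : l ∈ leftLimSet C t := by
      rw [leftLimSet, if_neg ht.ne']
      have h2 : Tendsto (fun s => edist l (z s)) (𝓝[<] t) (𝓝 0) := by
        have := tendsto_iff_edist_tendsto_0.1 hl
        simpa only [edist_comm] using this
      refine tendsto_of_tendsto_of_tendsto_of_le_of_le' tendsto_const_nhds h2
        (Eventually.of_forall fun _ => zero_le) ?_
      filter_upwards [Ioo_mem_nhdsLT ht] with s hs
      exact Metric.infEDist_le_edist_of_mem (hz.mem s hs.1.le)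
    have h3 : Metric.infEDist l (C t) = 0 :=
      le_antisymm (hC.leftContinuous t ht.le ▸ infEDist_le_excess h1 (C t)) zero_le
    exact (Metric.mem_iff_infEDist_zero_of_closed hP.isClosed).2 h3
  have hnormal : l - z t ∈ normalCone (C t) (z t) := by
    by_cases h0 : ν {t} = 0
    · rw [measureReal_def, h0, ENNReal.toReal_zero, zero_smul] at hatom
      rw [← neg_sub, ← hatom, neg_zero]
      exact zero_mem_normalCone (hz.mem t ht.le)
    · have h1 : -v t ∈ normalCone (C t) (z t) := by
        by_contra hnot
        exact h0 (measure_mono_null (singleton_subset_iff.2 hnot) (ae_iff.1 hN))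
      rw [← neg_sub, ← hatom, ← smul_neg]
      exact smul_mem_normalCone measureReal_nonneg h1
  have hzero : l - z t = 0 := by
    have h1 := hP.inner_le hr hnormal hlC
    have h2 := hj t ht
    rw [hlim, norm_sub_rev] at h2
    rw [real_inner_self_eq_norm_sq] at h1
    by_contra hne
    have h3 : 0 < ‖l - z t‖ := norm_pos_iff.2 hne
    have h4 : ‖l - z t‖ / (2 * r) < 1 := by rw [div_lt_one (by positivity)]; linarith
    have h5 : 0 < ‖l - z t‖ ^ 2 := by positivity
    nlinarith
  have hlz := sub_eq_zero.1 hzero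
  exact ⟨hlz ▸ hl, by rw [hatom, hlz, sub_self]⟩

/-- A solution with jumps smaller than `r` satisfies the step inequalities for every clock that
dominates its own variation, which has a continuous distribution function. -/
lemma IsSweepingSolution.exists_clock [CompleteSpace H] (hr : 0 < r) (hC : IsContBRLoc r C)
    {y₀ : H} {z : ℝ → H} (hz : IsSweepingSolution C y₀ z) (hj : JumpsLT r z) :
    ∃ n : ℝ → ℝ, Monotone n ∧ Continuous n ∧ ∀ m, HasClock r C m →
      (∀ s t, s ≤ t → n t - n s ≤ m t - m s) →
      ∀ s t, 0 ≤ s → s ≤ t → StepIneq r C m z s t := by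
  obtain ⟨μ, v, hloc, hd, hN⟩ := hz.inclusion
  set ν := μ.restrict (Ici 0) with hν
  have hvi : ∀ T, IntegrableOn v (Icc 0 T) ν := fun T =>
    (hloc.integrableOn_compact_subset Icc_subset_Ici_self isCompact_Icc).mono_measure
      Measure.restrict_le_self
  set ρ := ν.restrict (Ioi 0) with hρ
  have hvρ : ∀ a b, IntegrableOn v (Ioc a b) ρ := by
    intro a b
    rw [IntegrableOn, hρ, Measure.restrict_restrict measurableSet_Ioc]
    exact (hvi b).mono_set fun t ht => ⟨le_of_lt ht.2, ht.1.2⟩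
  -- the variation measure of `z`
  let κ : Measure ℝ := ρ.withDensity fun t => ‖v t‖ₑ
  have hκ : ∀ S, MeasurableSet S → κ S = ∫⁻ t in S, ‖v t‖ₑ ∂ρ := fun S hS => withDensity_apply _ hS
  have hκfin : ∀ a b, κ (Ioc a b) < ∞ := fun a b => by
    rw [hκ _ measurableSet_Ioc]; exact (hvρ a b).2
  have hnull : NullSingletonClass κ := by
    refine ⟨fun t => ?_⟩
    have hlt : κ {t} < ∞ :=
      (measure_mono (singleton_subset_iff.2 (right_mem_Ioc.2 (sub_one_lt t)))).trans_lt
        (hκfin (t - 1) t)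
    have he : κ {t} = ‖v t‖ₑ * ρ {t} := by
      rw [hκ _ (measurableSet_singleton t), lintegral_singleton]
    rcases le_or_gt t 0 with ht | ht
    · have h0 : ρ {t} = 0 := by
        rw [hρ, Measure.restrict_apply (measurableSet_singleton t),
          singleton_inter_eq_empty.2 (notMem_Ioi.2 ht), measure_empty]
      rw [he, h0, mul_zero]
    · have h1 := (hz.tendsto_left hr hC hj hvi hd hN ht).2
      have h2 : ρ {t} = ν {t} := by
        rw [hρ, Measure.restrict_apply (measurableSet_singleton t),
          inter_eq_left.2 (singleton_subset_iff.2 (mem_Ioi.2 ht))]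
      have h3 : (κ {t}).toReal = 0 := by
        rw [he, h2, ENNReal.toReal_mul, toReal_enorm, mul_comm, ← measureReal_def,
          ← Real.norm_of_nonneg (measureReal_nonneg (μ := ν) (s := {t})), ← norm_smul, h1,
          norm_zero]
      exact ((ENNReal.toReal_eq_zero_iff _).1 h3).resolve_right hlt.ne
  have hint : ∀ a b, IntervalIntegrable (fun _ => (1 : ℝ)) κ a b := fun a b =>
    ⟨integrableOn_const (hκfin a b).ne, integrableOn_const (hκfin b a).ne⟩
  have hsub : ∀ s t, s ≤ t →
      (∫ _ in (0 : ℝ)..t, (1 : ℝ) ∂κ) - ∫ _ in (0 : ℝ)..s, (1 : ℝ) ∂κ = κ.real (Ioc s t) := by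
    intro s t hst
    rw [intervalIntegral.integral_interval_sub_left (hint 0 t) (hint 0 s),
      intervalIntegral.integral_of_le hst, setIntegral_const, smul_eq_mul, mul_one]
  refine ⟨fun t => ∫ _ in (0 : ℝ)..t, (1 : ℝ) ∂κ, fun s t hst => ?_,
    intervalIntegral.continuous_primitive hint 0, fun m hm hnm s t hs hst => ?_⟩
  · have := hsub s t hst
    have h2 : 0 ≤ κ.real (Ioc s t) := measureReal_nonneg
    dsimp only
    linarith
  · have hsubset : Ioc s t ⊆ Icc 0 t := fun τ hτ => ⟨hs.trans hτ.1.le, hτ.2⟩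
    have hrestr : ρ.restrict (Ioc s t) = ν.restrict (Ioc s t) :=
      Measure.restrict_restrict_of_subset fun τ hτ => hs.trans_lt hτ.1
    refine hm.stepIneq_of_density hr hs hst ((hvi t).mono_set hsubset) (ae_restrict_of_ae hN)
      (fun τ hτ => ?_) ?_
    · rcases hτ.1.eq_or_lt with rfl | hlt
      · simp
      · rw [(hd s τ hlt).2.2.2,
          rightLim_extendHalfLine z (hs.trans hτ.1) (hz.rightContinuous τ (hs.trans hτ.1)),
          rightLim_extendHalfLine z hs (hz.rightContinuous s hs)]
    · refine le_trans (le_of_eq ?_) (hnm s t hst)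
      dsimp only
      rw [hsub s t hst, measureReal_def, hκ _ measurableSet_Ioc, hrestr,
        integral_norm_eq_lintegral_enorm ((hvi t).mono_set hsubset).aestronglyMeasurable]

lemma IsContBRLoc.hasClock [CompleteSpace H] (hC : IsContBRLoc r C) :
    HasClock r C (retClock C) :=
  ⟨hC.proxRegular, monotone_retClock hC.retraction_lt_top, continuous_retClock hC,
    fun _ _ hs hst => excess_le_retClock hC.retraction_lt_top hs hst⟩

/-- Two solutions with jumps smaller than `r` coincide. -/
theorem IsSweepingSolution.eqOn [CompleteSpace H] (hr : 0 < r) (hC : IsContBRLoc r C)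
    {y₀ : H} {y z : ℝ → H} (hy : IsSweepingSolution C y₀ y) (hyj : JumpsLT r y)
    (hz : IsSweepingSolution C y₀ z) (hzj : JumpsLT r z) : EqOn y z (Ici 0) := by
  obtain ⟨n, hn, hnc, hny⟩ := hy.exists_clock hr hC hyj
  obtain ⟨k, hk, hkc, hkz⟩ := hz.exists_clock hr hC hzj
  have hcl := hC.hasClock
  have hm : HasClock r C (fun t => retClock C t + n t + k t) := by
    refine ⟨hC.proxRegular, (hcl.mono.add hn).add hk, (hcl.cont.add hnc).add hkc,
      fun s t hs hst => (hcl.excess_le s t hs hst).trans (ENNReal.ofReal_le_ofReal ?_)⟩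
    have := hn hst
    have := hk hst
    linarith
  refine hm.eqOn_of_stepIneq hr (hny _ hm fun s t hst => ?_) (hkz _ hm fun s t hst => ?_)
    hy.mem hz.mem (singleton_injective (hy.initial.symm.trans hz.initial))
  · have := hcl.mono hst
    have := hk hst
    linarith
  · have := hcl.mono hst
    have := hn hst
    linarith

end Uniqueness

/-! ### Continuous, Lipschitz and absolutely continuous moving sets -/

section Regularity

variable {H : Type*} [NormedAddCommGroup H]

lemma jumpsLT_of_continuousOn {r : ℝ} (hr : 0 < r) {y : ℝ → H} (hy : ContinuousOn y (Ici 0)) :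
    JumpsLT r y := by
  intro t ht
  rw [(hy.continuousAt (Ici_mem_nhds ht)).continuousWithinAt.leftLim_eq, sub_self, norm_zero]
  exact hr

lemma absolutelyContinuousOnInterval_of_dist_le {y : ℝ → H} {m : ℝ → ℝ} {a b : ℝ}
    (hm : AbsolutelyContinuousOnInterval m a b)
    (h : ∀ s ∈ uIcc a b, ∀ t ∈ uIcc a b, dist (y s) (y t) ≤ dist (m s) (m t)) :
    AbsolutelyContinuousOnInterval y a b := by
  rw [absolutelyContinuousOnInterval_iff] at hm ⊢
  intro ε hε
  obtain ⟨δ, hδ, hm⟩ := hm ε hε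
  refine ⟨δ, hδ, fun E hE hsum => lt_of_le_of_lt ?_ (hm E hE hsum)⟩
  exact Finset.sum_le_sum fun i hi => h _ (hE.1 i hi).1 _ (hE.1 i hi).2

lemma infDist_lt_of_exists_mem {r : ℝ} {K : Set H} {y₀ : H}
    (hy₀ : ∃ x ∈ K, y₀ - x ∈ Metric.ball (0 : H) r) : Metric.infDist y₀ K < r := by
  obtain ⟨x, hx, h⟩ := hy₀
  rw [mem_ball_zero_iff, ← dist_eq_norm] at h
  exact (Metric.infDist_le_dist_of_mem hx).trans_lt h

variable [InnerProductSpace ℝ H] {r : ℝ} {C : ℝ → Set H}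

lemma IsBRLocRight.isContBRLoc (hC : IsBRLocRight r C) {m : ℝ → ℝ} (hm : Continuous m)
    (he : ∀ s t, 0 ≤ s → s < t → excess (C s) (C t) ≤ ENNReal.ofReal (m t - m s)) :
    IsContBRLoc r C := by
  refine ⟨hC, fun t ht => ?_⟩
  rcases ht.eq_or_lt with rfl | ht
  · rw [leftLimSet, if_pos rfl, excess_self]
  · rw [leftLimSet, if_neg ht.ne']
    refine le_antisymm (iSup₂_le fun x hx => ?_) zero_le
    have h1 : Tendsto (fun s => Metric.infEDist x (C s) + ENNReal.ofReal (m t - m s)) (𝓝[<] t)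
        (𝓝 (0 + ENNReal.ofReal (m t - m t))) :=
      Tendsto.add hx (ENNReal.tendsto_ofReal
        (((hm.tendsto t).mono_left nhdsWithin_le_nhds).const_sub _))
    rw [sub_self, ENNReal.ofReal_zero, add_zero] at h1
    refine ge_of_tendsto h1 ?_
    filter_upwards [Ioo_mem_nhdsLT ht] with s hs
    exact (infEDist_le_infEDist_add_excess x (C s) (C t)).trans
      (add_le_add_right (he s t hs.1.le hs.2) _)

/-- For a continuous moving set the sweeping process has a unique solution with jumps smaller
than `r`; it is continuous. The clock is the accumulated retraction. -/
theorem IsContBRLoc.exists_isSw [CompleteSpace H] (hr : 0 < r) (hC : IsContBRLoc r C) {y₀ : H}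
    (hy₀ : Metric.infDist y₀ (C 0) < r) : ∃ y : ℝ → H, IsSw r C y₀ y ∧
      ContinuousOn y (Ici 0) ∧ LocallyBoundedVariationOn y (Ici 0) := by
  have hcl := hC.hasClock
  let F : StieltjesFunction ℝ := ⟨retClock C, hcl.mono, fun x => hcl.cont.continuousWithinAt⟩
  have hF : HasDistribution F.measure (retClock C) := fun s t => F.measure_Ioc s t
  obtain ⟨y, -, hsol, hy, -⟩ := hcl.exists_solution hr hF hy₀
  have hcont := continuousOn_of_norm_sub_le hcl.cont hy
  have hj := jumpsLT_of_continuousOn hr hcont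
  refine ⟨y, ⟨hsol, hj, fun z hz hzj => hz.eqOn hr hC hzj hsol hj, fun s t hs hst => ?_⟩,
    hcont, hsol.locallyBV⟩
  rw [retraction_Icc_eq hC.retraction_lt_top hs hst.le]
  exact eVariationOn_le_of_norm_sub_le hcl.mono hy hs hst.le

lemma IsSw.lipschitzOnWith (hC : IsBRLocRight r C) {y₀ : H} {y : ℝ → H} (hy : IsSw r C y₀ y)
    {L : ℝ≥0} (hL : ∀ t s, 0 ≤ t → t < s →
      excess (C t) (C s) ≤ ENNReal.ofReal (L * (s - t))) : LipschitzOnWith L y (Ici 0) := by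
  have key : ∀ s t, 0 ≤ s → s < t → dist (y s) (y t) ≤ L * (t - s) := by
    intro s t hs hst
    have h1 := (eVariationOn.edist_le y (left_mem_Icc.2 hst.le) (right_mem_Icc.2 hst.le)).trans
      (hy.variation_le s t hs hst)
    have h2 := retClock_sub_le hC.retraction_lt_top (g := fun t => L * t) hs hst.le
      (fun a _ b _ hab => mul_le_mul_of_nonneg_left hab L.coe_nonneg)
      (fun a ha b _ hab => by rw [← mul_sub]; exact hL a b (hs.trans ha.1) hab)
    rw [retraction_Icc_eq hC.retraction_lt_top hs hst.le, edist_dist] at h1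
    have h3 := (ENNReal.ofReal_le_ofReal_iff
      (sub_nonneg.2 (monotone_retClock hC.retraction_lt_top hst.le))).1 h1
    rw [mul_sub]
    exact h3.trans h2
  refine LipschitzOnWith.of_dist_le_mul fun s hs t ht => ?_
  rcases lt_trichotomy s t with h | rfl | h
  · rw [dist_comm s t, Real.dist_eq, abs_of_pos (sub_pos.2 h)]; exact key s t hs h
  · simp
  · rw [dist_comm (y s), Real.dist_eq, abs_of_pos (sub_pos.2 h)]; exact key t s ht h

/-- A continuous primitive of a Lebesgue integrable function is of class `W^{1,1}`. -/
lemma memW11_of_integral {y g : ℝ → H} {T : ℝ} (hy : ContinuousOn y (Ici 0))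
    (hg : IntegrableOn g (Ioc 0 T))
    (hint : ∀ s t, 0 ≤ s → s ≤ t → ∫ τ in Ioc s t, g τ = y t - y s) : MemW11 T y := by
  refine ⟨hy.mono Icc_subset_Ici_self, g,
    (integrableOn_Icc_iff_integrableOn_Ioc (by simp)).2 hg, ?_⟩
  refine isDifferentialMeasure_of_continuous (hy.comp_continuous (by fun_prop)
    fun t => mem_Ici.2 (le_max_left _ _)) fun c d hcd => ?_
  have hset : Ioc c d ∩ Ioc 0 T = Ioc (max 0 (min c T)) (max 0 (min d T)) := by
    ext x
    simp only [mem_inter_iff, mem_Ioc, max_lt_iff, min_lt_iff, le_max_iff, le_min_iff]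
    constructor
    · rintro ⟨⟨h1, h2⟩, h3, h4⟩
      exact ⟨⟨h3, Or.inl h1⟩, Or.inr ⟨h2, h4⟩⟩
    · rintro ⟨⟨h1, h2⟩, h3⟩
      rcases h3 with h3 | ⟨h3, h4⟩
      · exact absurd h1 (not_lt.2 h3)
      · exact ⟨⟨h2.resolve_right (not_lt.2 h4), h3⟩, h1, h4⟩
  rw [← Measure.restrict_congr_set Ioc_ae_eq_Icc, Measure.restrict_restrict measurableSet_Ioc,
    hset, hint _ _ (le_max_left _ _) (max_le_max le_rfl (min_le_min_right _ hcd.le))]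
  rfl

lemma ae_hasDerivAt_of_integral [CompleteSpace H] {y g : ℝ → H}
    (hg : ∀ T, IntegrableOn g (Ioc 0 T))
    (hint : ∀ s t, 0 ≤ s → s ≤ t → ∫ τ in Ioc s t, g τ = y t - y s) :
    ∀ᵐ t ∂volume.restrict (Ioi (0 : ℝ)), HasDerivAt y (g t) t := by
  have h1 : ∀ᵐ t : ℝ, ∀ N : ℕ, t ∈ uIcc 0 (N : ℝ) → ∀ c ∈ uIcc 0 (N : ℝ),
      HasDerivAt (fun x => ∫ τ in c..x, g τ) (g t) t :=
    ae_all_iff.2 fun N => IntervalIntegrable.ae_hasDerivAt_integral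
      ((intervalIntegrable_iff_integrableOn_Ioc_of_le (Nat.cast_nonneg N)).2 (hg N))
  filter_upwards [ae_restrict_of_ae h1, ae_restrict_mem measurableSet_Ioi] with t ht ht0
  have ht0 : 0 < t := ht0
  obtain ⟨N, hN⟩ := exists_nat_ge t
  have h2 := ht N (by rw [uIcc_of_le (Nat.cast_nonneg N)]; exact ⟨ht0.le, hN⟩) 0 left_mem_uIcc
  refine (h2.const_add (y 0)).congr_of_eventuallyEq ?_
  filter_upwards [Ioi_mem_nhds ht0] with x hx
  rw [intervalIntegral.integral_of_le (le_of_lt hx), hint 0 x le_rfl (le_of_lt hx),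
    add_sub_cancel]

end Regularity

section AbsolutelyContinuous

variable {α : ℝ → ℝ}

/-- The speed `|α'|` on `(0, ∞)`, extended by zero. -/
noncomputable def speed (α : ℝ → ℝ) : ℝ → ℝ := (Ioi 0).indicator fun t => ‖deriv α t‖

lemma speed_nonneg (α : ℝ → ℝ) (t : ℝ) : 0 ≤ speed α t :=
  indicator_nonneg (fun _ _ => norm_nonneg _) t

lemma measurable_speed (α : ℝ → ℝ) : Measurable (speed α) :=
  (measurable_deriv α).norm.indicator measurableSet_Ioi

lemma integrableOn_deriv_Ioc (hα : ∀ T, 0 < T → AbsolutelyContinuousOnInterval α 0 T) (b : ℝ) :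
    IntegrableOn (deriv α) (Ioc 0 b) := by
  have h1 : (0 : ℝ) < |b| + 1 := by positivity
  have h2 := (hα _ h1).intervalIntegrable_deriv
  rw [intervalIntegrable_iff_integrableOn_Ioc_of_le h1.le] at h2
  exact h2.mono_set (Ioc_subset_Ioc_right (by linarith [le_abs_self b]))

lemma integrableOn_speed (hα : ∀ T, 0 < T → AbsolutelyContinuousOnInterval α 0 T) (a b : ℝ) :
    IntegrableOn (speed α) (Ioc a b) := by
  rw [speed, integrableOn_indicator_iff measurableSet_Ioi]
  exact IntegrableOn.mono_set (integrableOn_deriv_Ioc hα b).norm fun t ht => ⟨ht.1, ht.2.2⟩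

lemma intervalIntegrable_speed (hα : ∀ T, 0 < T → AbsolutelyContinuousOnInterval α 0 T)
    (a b : ℝ) : IntervalIntegrable (speed α) volume a b :=
  ⟨integrableOn_speed hα a b, integrableOn_speed hα b a⟩

/-- The variation `∫₀ᵗ |α'|` of `α`. -/
noncomputable def speedClock (α : ℝ → ℝ) (t : ℝ) : ℝ := ∫ τ in (0 : ℝ)..t, speed α τ

lemma speedClock_sub (hα : ∀ T, 0 < T → AbsolutelyContinuousOnInterval α 0 T) {s t : ℝ}
    (hst : s ≤ t) : speedClock α t - speedClock α s = ∫ τ in Ioc s t, speed α τ := by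
  rw [speedClock, speedClock, intervalIntegral.integral_interval_sub_left
    (intervalIntegrable_speed hα 0 t) (intervalIntegrable_speed hα 0 s),
    intervalIntegral.integral_of_le hst]

lemma monotone_speedClock (hα : ∀ T, 0 < T → AbsolutelyContinuousOnInterval α 0 T) :
    Monotone (speedClock α) := fun s t hst => by
  rw [← sub_nonneg, speedClock_sub hα hst]
  exact integral_nonneg (speed_nonneg α)

lemma hasDistribution_speedClock (hα : ∀ T, 0 < T → AbsolutelyContinuousOnInterval α 0 T) :
    HasDistribution (volume.withDensity fun t => ENNReal.ofReal (speed α t)) (speedClock α) := by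
  intro s t
  rcases le_or_gt s t with hst | hst
  · rw [withDensity_apply _ measurableSet_Ioc, speedClock_sub hα hst,
      ofReal_integral_eq_lintegral_ofReal (integrableOn_speed hα s t)
        (Eventually.of_forall (speed_nonneg α))]
  · rw [Ioc_eq_empty (not_lt.2 hst.le), measure_empty,
      ENNReal.ofReal_of_nonpos (sub_nonpos.2 (monotone_speedClock hα hst.le))]

variable {H : Type*} [NormedAddCommGroup H] [InnerProductSpace ℝ H] {r : ℝ} {C : ℝ → Set H}

lemma IsBRLocRight.hasClock_speedClock (hC : IsBRLocRight r C)
    (hα : ∀ T, 0 < T → AbsolutelyContinuousOnInterval α 0 T)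
    (he : ∀ t s, 0 ≤ t → t < s →
      excess (C t) (C s) ≤ ENNReal.ofReal (∫ τ in t..s, deriv α τ)) :
    HasClock r C (speedClock α) := by
  refine ⟨hC.proxRegular, monotone_speedClock hα,
    intervalIntegral.continuous_primitive (intervalIntegrable_speed hα) 0,
    fun s t hs hst => ?_⟩
  rcases hst.eq_or_lt with rfl | hst
  · simp [excess_self]
  refine (he s t hs hst).trans (ENNReal.ofReal_le_ofReal ?_)
  rw [speedClock_sub hα hst.le, intervalIntegral.integral_of_le hst.le]
  refine setIntegral_mono_on ((integrableOn_deriv_Ioc hα t).mono_set (Ioc_subset_Ioc_left hs))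
    (integrableOn_speed hα s t) measurableSet_Ioc fun τ hτ => ?_
  rw [speed, indicator_of_mem (mem_Ioi.2 (hs.trans_lt hτ.1))]
  exact Real.le_norm_self _

/-- For an absolutely continuous moving set the solution has a Lebesgue density, so that it is
absolutely continuous and solves the differential inclusion almost everywhere. -/
lemma IsBRLocRight.exists_velocity [CompleteSpace H] (hr : 0 < r) (hC : IsBRLocRight r C)
    (hα : ∀ T, 0 < T → AbsolutelyContinuousOnInterval α 0 T)
    (he : ∀ t s, 0 ≤ t → t < s →
      excess (C t) (C s) ≤ ENNReal.ofReal (∫ τ in t..s, deriv α τ))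
    {y₀ : H} (hy₀ : Metric.infDist y₀ (C 0) < r) :
    ∃ y g : ℝ → H, IsSweepingSolution C y₀ y ∧
      (∀ s t, 0 ≤ s → s ≤ t → ‖y t - y s‖ ≤ speedClock α t - speedClock α s) ∧
      (∀ T, IntegrableOn g (Ioc 0 T)) ∧
      (∀ s t, 0 ≤ s → s ≤ t → ∫ τ in Ioc s t, g τ = y t - y s) ∧
      ∀ᵐ t ∂volume.restrict (Ioi (0 : ℝ)), -g t ∈ normalCone (C t) (y t) := by
  obtain ⟨y, v, hsol, hy, hvi, hvN, hv⟩ :=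
    (hC.hasClock_speedClock hα he).exists_solution hr (hasDistribution_speedClock hα) hy₀
  have hmeas : Measurable fun t => ENNReal.ofReal (speed α t) := (measurable_speed α).ennreal_ofReal
  have hfin : ∀ S : Set ℝ, ∀ᵐ t ∂volume.restrict S, ENNReal.ofReal (speed α t) < ∞ :=
    fun S => Eventually.of_forall fun _ => ENNReal.ofReal_lt_top
  refine ⟨y, fun t => speed α t • v t, hsol, hy, fun T => ?_, fun s t hs hst => ?_, ?_⟩
  · have h1 := hvi T
    rw [IntegrableOn, restrict_withDensity measurableSet_Ioc,
      integrable_withDensity_iff_integrable_smul' hmeas (hfin _)] at h1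
    simpa only [ENNReal.toReal_ofReal (speed_nonneg α _), IntegrableOn] using h1
  · rw [← hv s t hs hst, restrict_withDensity measurableSet_Ioc,
      integral_withDensity_eq_integral_toReal_smul hmeas (hfin _)]
    simp only [ENNReal.toReal_ofReal (speed_nonneg α _)]
  · rw [restrict_withDensity measurableSet_Ioi, ae_withDensity_iff hmeas] at hvN
    filter_upwards [hvN, ae_restrict_mem measurableSet_Ioi] with t h1 h2
    by_cases h0 : speed α t = 0
    · rw [h0, zero_smul, neg_zero]
      exact zero_mem_normalCone (hsol.mem t (le_of_lt h2))
    · rw [← smul_neg]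
      refine smul_mem_normalCone (speed_nonneg α t) (h1 ?_)
      exact (ENNReal.ofReal_pos.2 (lt_of_le_of_ne (speed_nonneg α t) (Ne.symm h0))).ne'

end AbsolutelyContinuous

end Sweeping

theorem mainTheorem3 {H : Type*} [NormedAddCommGroup H] [InnerProductSpace ℝ H] [CompleteSpace H]
    (r : ℝ) (hr : 0 < r) (C : ℝ → Set H) (hC : Sweeping.IsBRLocRight r C)
    (y₀ : H) (hy₀ : ∃ x ∈ C 0, y₀ - x ∈ Metric.ball (0 : H) r) :
    -- (i) `C` continuous
    (Sweeping.IsContBRLoc r C →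
      ∃ y : ℝ → H, Sweeping.IsSw r C y₀ y ∧
        ContinuousOn y (Ici 0) ∧ LocallyBoundedVariationOn y (Ici 0)) ∧
    -- (ii) `C` locally absolutely continuous
    (∀ α : ℝ → ℝ, (∀ T, 0 < T → AbsolutelyContinuousOnInterval α 0 T) →
      (∀ t s, 0 ≤ t → t < s → Sweeping.excess (C t) (C s) ≤ ENNReal.ofReal (∫ τ in t..s, deriv α τ)) →
      ∃ y : ℝ → H, Sweeping.IsSw r C y₀ y ∧
        (∀ T, 0 < T → AbsolutelyContinuousOnInterval y 0 T ∧ Sweeping.MemW11 T y) ∧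
        (∀ t, 0 ≤ t → y t ∈ C t) ∧
        Sweeping.proj (C 0) y₀ = {y 0} ∧
        ∀ᵐ t ∂(volume.restrict (Ici (0 : ℝ))),
          DifferentiableAt ℝ y t ∧ -deriv y t ∈ Sweeping.normalCone (C t) (y t)) ∧
    -- (iii) `C` Lipschitz continuous
    (∀ L : ℝ≥0, (∀ t s, 0 ≤ t → t < s → Sweeping.excess (C t) (C s) ≤ ENNReal.ofReal (L * (s - t))) →
      ∃ y : ℝ → H, Sweeping.IsSw r C y₀ y ∧ LipschitzOnWith L y (Ici 0)) := by
  have hd := Sweeping.infDist_lt_of_exists_mem hy₀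
  refine ⟨fun hC' => hC'.exists_isSw hr hd, fun α hα he => ?_, fun L hL => ?_⟩
  · have hcl := hC.hasClock_speedClock hα he
    have hC' := hC.isContBRLoc hcl.cont fun s t hs hst => hcl.excess_le s t hs hst.le
    obtain ⟨y, hSw, hcont, -⟩ := hC'.exists_isSw hr hd
    obtain ⟨z, g, hz, hzle, hgi, hgint, hgN⟩ := hC.exists_velocity hr hα he hd
    -- by uniqueness the solution with a Lebesgue density is `y`
    have hzy : EqOn z y (Ici 0) := hSw.unique z hz
      (Sweeping.jumpsLT_of_continuousOn hr (Sweeping.continuousOn_of_norm_sub_le hcl.cont hzle))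
    have hint : ∀ s t, 0 ≤ s → s ≤ t → ∫ τ in Ioc s t, g τ = y t - y s := fun s t hs hst => by
      rw [hgint s t hs hst, hzy hs, hzy (hs.trans hst)]
    have hyle : ∀ s t, 0 ≤ s → s ≤ t →
        ‖y t - y s‖ ≤ Sweeping.speedClock α t - Sweeping.speedClock α s := fun s t hs hst => by
      rw [← hzy hs, ← hzy (hs.trans hst)]; exact hzle s t hs hst
    refine ⟨y, hSw, fun T hT => ⟨?_, Sweeping.memW11_of_integral hcont (hgi T) hint⟩,
      hSw.solution.mem, hSw.solution.initial, ?_⟩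
    · refine Sweeping.absolutelyContinuousOnInterval_of_dist_le
        ((Sweeping.intervalIntegrable_speed hα 0 T).absolutelyContinuousOnInterval_intervalIntegral
          left_mem_uIcc) fun s hs t ht => ?_
      rw [uIcc_of_le hT.le] at hs ht
      change _ ≤ dist (Sweeping.speedClock α s) (Sweeping.speedClock α t)
      rcases le_total s t with hst | hst
      · rw [dist_comm, dist_comm (Sweeping.speedClock α s), dist_eq_norm, Real.dist_eq]
        exact (hyle s t hs.1 hst).trans (le_abs_self _)
      · rw [dist_eq_norm, Real.dist_eq]
        exact (hyle t s ht.1 hst).trans (le_abs_self _)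
    · rw [← Measure.restrict_congr_set Ioi_ae_eq_Ici]
      filter_upwards [Sweeping.ae_hasDerivAt_of_integral hgi hint, hgN,
        ae_restrict_mem measurableSet_Ioi] with t h1 h2 h3
      rw [hzy (mem_Ici.2 (le_of_lt h3))] at h2
      exact ⟨h1.differentiableAt, by rwa [h1.deriv]⟩
  · have hC' := hC.isContBRLoc (m := fun t => L * t) (by fun_prop) fun s t hs hst => by
      rw [← mul_sub]; exact hL s t hs hst
    obtain ⟨y, hSw, -⟩ := hC'.exists_isSw hr hd
    exact ⟨y, hSw, hSw.lipschitzOnWith hC hL⟩
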